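/- Let $d\ge 1$ and $M$ be integers with $2d\le M\le e^d$. Put $\ell=\lceil \log_5 (M/d)\rceil$ and split $\{1,\dots,d\}$ into consecutive intervals $I_1,\dots,I_{\lceil d/\ell\rceil}$, each of length $\ell$ except possibly the last one. For each $k$ fix a $(1/2)$-net $\mathcal N_k$ (in the Euclidean metric) of the unit sphere $S^{d-1}\cap\mathbb R^{I_k}$ of the coordinate subspace $\mathbb R^{I_k}$, with $|\mathcal N_k|\le 5^{\ell}$. For $X_1,\dots,X_M\in S^{d-1}$ let $$V_M(X_1,\dots,X_M)=\operatorname{absconv}\Big(\{e_1,\dots,e_d\}\cup\bigcup_{k=1}^{\lceil d/\ell\rceil}\mathcal N_k\cup\{X_1,\dots,X_M\}\Big),$$ where $e_1,\dots,e_d$ is the standard basis and $\operatorname{absconv}(K)=\operatorname{conv}(K\cup -K)$. For convex bodies $K_1,K_2\subset\mathbb R^d$ let $$d(K_1,K_2)=\inf\{\lambda>0 : K_1-a\subset T(K_2-b)\subset\lambda(K_1-a)\text{ for some } T\in GL(\mathbb R^d),\ a,b\in\mathbb R^d\}$$ be their Banach–Mazur distance. Theorem 2.2. There is an absolute constant $a>0$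 such that, for all integers $d\ge 1$ and $2d\le M\le e^d$ and every choice of the nets $\mathcal N_k$ as above, the following holds. If $X'_1,\dots,X'_M,X''_1,\dots,X''_M$ are independent random vectors uniformly distributed on $S^{d-1}$, and $V_M'=V_M(X'_1,\dots,X'_M)$, $V_M''=V_M(X''_1,\dots,X''_M)$ (with the same nets), then $$\mathbb P\left(d(V_M',V_M'')\le \frac{a\,d}{\ln (M/d)}\right)\le 2e^{-dM}.$$ -/

import Mathlib

open MeasureTheory
open scoped Pointwise

noncomputable section

namespace Gluskin

/-- `ℝ^d` with its Euclidean norm. -/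
abbrev E (d : ℕ) : Type := EuclideanSpace ℝ (Fin d)

/-- The unit sphere `S^{d-1}` of `ℝ^d`. -/
abbrev UnitSphere (d : ℕ) : Type := Metric.sphere (0 : E d) 1

/-- The rotation invariant probability measure on `S^{d-1}`: the surface measure induced by
Lebesgue measure, divided by its total mass. -/
def sphereProb (d : ℕ) : Measure (UnitSphere d) :=
  ((volume : Measure (E d)).toSphere Set.univ)⁻¹ • (volume : Measure (E d)).toSphere

theorem isProbabilityMeasure_sphereProb {d : ℕ} (hd : 1 ≤ d) :
    IsProbabilityMeasure (sphereProb d) := by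
  have : Nonempty (Fin d) := ⟨⟨0, hd⟩⟩
  have : NeZero (volume : Measure (E d)).toSphere :=
    ⟨Measure.toSphere_ne_zero _⟩
  exact inferInstanceAs (IsProbabilityMeasure
    (((volume : Measure (E d)).toSphere Set.univ)⁻¹ • (volume : Measure (E d)).toSphere))

/-- The law of `M` independent uniformly distributed random points of `S^{d-1}`. -/
def sampleLaw (d M : ℕ) : Measure (Fin M → UnitSphere d) :=
  Measure.pi fun _ => sphereProb d

/-- The Banach–Mazur distance of two convex bodies in `ℝ^d`: the infimum of all `r > 0` with
`K₁ - a ⊆ T (K₂ - b) ⊆ r (K₁ - a)` for some invertible linear `T` and some `a`, `b`.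
For convex bodies (compact convex sets with non-empty interior) there are such `r`. -/
def banachMazur {d : ℕ} (K₁ K₂ : Set (E d)) : ℝ :=
  sInf {r : ℝ | 0 < r ∧ ∃ (T : E d ≃ₗ[ℝ] E d) (a b : E d),
    (fun x => x - a) '' K₁ ⊆ T '' ((fun x => x - b) '' K₂) ∧
    T '' ((fun x => x - b) '' K₂) ⊆ r • ((fun x => x - a) '' K₁)}

/-- The block length `ℓ = ⌈log_5 (M / d)⌉`. -/
def blockLength (d M : ℕ) : ℕ := ⌈Real.logb 5 ((M : ℝ) / (d : ℝ))⌉₊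

/-- The number of blocks `⌈d / ℓ⌉`. -/
def numBlocks (d M : ℕ) : ℕ := ⌈(d : ℝ) / (blockLength d M : ℝ)⌉₊

/-- The `k`-th block of coordinates (everything counted from `0`): the coordinates
`kℓ, …, kℓ + ℓ - 1`, as far as they are smaller than `d`. -/
def block (d M k : ℕ) : Set (Fin d) :=
  {i | k * blockLength d M ≤ (i : ℕ) ∧ (i : ℕ) < (k + 1) * blockLength d M}

/-- The unit vectors that are supported in the `k`-th block of coordinates. -/
def blockSphere (d M k : ℕ) : Set (E d) :=
  {x | ‖x‖ = 1 ∧ ∀ i, i ∉ block d M k → x i = 0}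

/-- `N k` is, for each block `k`, a `1/2`-net of cardinality at most `5^ℓ` in the unit sphere of
the coordinate subspace of that block. -/
def IsBlockNets (d M : ℕ) (N : Fin (numBlocks d M) → Finset (E d)) : Prop :=
  ∀ k, (N k : Set (E d)) ⊆ blockSphere d M k ∧
    (N k).card ≤ 5 ^ blockLength d M ∧
    ∀ x ∈ blockSphere d M k, ∃ y ∈ N k, dist x y ≤ 1 / 2

/-- The modified Gluskin polytope: the absolute convex hull of the standard basis, of the nets
and of the points `X_1, …, X_M`. -/
def polytope (d M : ℕ) (N : Fin (numBlocks d M) → Finset (E d)) (X : Fin M → UnitSphere d) :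
    Set (E d) :=
  absConvexHull ℝ
    (Set.range (fun i : Fin d => (EuclideanSpace.single i (1 : ℝ) : E d)) ∪
      (⋃ k, (N k : Set (E d))) ∪ Set.range (fun j : Fin M => (X j : E d)))

end Gluskin

end

/-! Gluskin's random polytope argument: each polytope has small volume, so a fixed linear map of
large determinant rarely sends all the vertices of one into a multiple of the other, and all maps
can be treated at once by a net.

By symmetry the centres in the distance can be taken to be zero. If the distance is at most s, some
T and r < 2s give V' ⊆ T V'' ⊆ r V'. The maps T/√r and √r T⁻¹ are mutually inverse, so one of them
has |det| ≥ 1; with ρ = √(2s) it sends one polytope into ρ times the other. The two cases differ by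
swapping the samples (`banachMazur_le_subset_badPairs`).

Fix the target V. It is the convex hull of at most 13M points of the unit ball, so Maurey's method
gives vol V ≤ α^d vol B with α = e^16 √(log(M/d)/d) (`volume_polytope_le`). If |det S| ≥ 1, a
uniform point of the sphere satisfies S x ∈ 2ρV with probability at most (2ρα)^d, and M independent
points all do so with probability at most (2ρα)^(dM).

The admissible maps have all their columns in ρV. Comparing volumes with the operator norm ball
gives a net of at most 2(160α√d)^(d²) maps at operator distance ρ/√d (`exists_net_goodMaps`). As V
contains the ball of radius 1/√d, passing to the net only replaces ρV by 2ρV. With s a small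
multiple of d/log(M/d), 2ρα is a small constant and its power dM beats the size of the net. -/

noncomputable section

namespace Gluskin

/-! ### Volume of the convex hull of few points in the unit ball -/

/-- Maurey's empirical method: a convex combination of vectors of norm at most one is
within `1 / √k` of an average of `k` of them. -/
theorem exists_sym_norm_smul_sub_sum_sq_le {F κ : Type*} [NormedAddCommGroup F]
    [InnerProductSpace ℝ F] {w : κ → F} (hw : ∀ i, ‖w i‖ ≤ 1) {x : F}
    (hx : x ∈ convexHull ℝ (Set.range w)) (k : ℕ) :
    ∃ m : Sym κ k, ‖(k : ℝ) • x - ((m : Multiset κ).map w).sum‖ ^ 2 ≤ k := by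
  induction k with
  | zero => exact ⟨Sym.nil, by simp⟩
  | succ k ih =>
    obtain ⟨m, hm⟩ := ih
    set y := (k : ℝ) • x - ((m : Multiset κ).map w).sum with hy
    have hlin : ConvexOn ℝ Set.univ (fun v : F => inner ℝ (y + x) v) :=
      (innerₗ F (y + x)).convexOn convex_univ
    -- Greedy choice: a linear functional is at least as large at some vertex as at `x`. Taking it
    -- along `y + x` keeps the cross term from increasing the squared error by more than 1.
    obtain ⟨v, ⟨i, rfl⟩, hi⟩ := hlin.exists_ge_of_mem_convexHull (Set.subset_univ _) hx
    refine ⟨i ::ₛ m, ?_⟩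
    have e : ((k + 1 : ℕ) : ℝ) • x - (((i ::ₛ m : Sym κ (k + 1)) : Multiset κ).map w).sum
        = (y + x) - w i := by
      simp only [hy, Sym.coe_cons, Multiset.map_cons, Multiset.sum_cons]
      push_cast
      module
    rw [e, norm_sub_sq_real]
    have h1 : ‖w i‖ ^ 2 ≤ 1 := pow_le_one₀ (norm_nonneg _) (hw i)
    have h2 : ‖y + x‖ ^ 2 = ‖y‖ ^ 2 + 2 * inner ℝ y x + ‖x‖ ^ 2 := norm_add_sq_real _ _
    have h3 : inner ℝ (y + x) x = inner ℝ y x + ‖x‖ ^ 2 := by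
      rw [inner_add_left, real_inner_self_eq_norm_sq]
    rw [h3] at hi
    push_cast
    nlinarith [sq_nonneg ‖x‖]

/-- The balls of radius 1/√k around the averages of k points cover the hull; the binomial
coefficient counts the multisets of size k. -/
theorem volume_convexHull_range_le {d : ℕ} {κ : Type*} [Fintype κ] {w : κ → E d}
    (hw : ∀ i, ‖w i‖ ≤ 1) {k : ℕ} (hk : 0 < k) :
    volume (convexHull ℝ (Set.range w)) ≤
      ((Fintype.card κ + k - 1).choose k : ENNReal) *
        (ENNReal.ofReal ((√k)⁻¹ ^ d) * volume (Metric.ball (0 : E d) 1)) := by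
  classical
  have hk' : (0 : ℝ) < k := by exact_mod_cast hk
  have hsub : convexHull ℝ (Set.range w) ⊆
      ⋃ m : Sym κ k, Metric.closedBall ((k : ℝ)⁻¹ • ((m : Multiset κ).map w).sum) (√k)⁻¹ := by
    intro x hx
    obtain ⟨m, hm⟩ := exists_sym_norm_smul_sub_sum_sq_le hw hx k
    refine Set.mem_iUnion.2 ⟨m, ?_⟩
    rw [mem_closedBall_iff_norm]
    have e : x - (k : ℝ)⁻¹ • ((m : Multiset κ).map w).sum
        = (k : ℝ)⁻¹ • ((k : ℝ) • x - ((m : Multiset κ).map w).sum) := by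
      rw [smul_sub, smul_smul, inv_mul_cancel₀ hk'.ne', one_smul]
    rw [e, norm_smul, Real.norm_of_nonneg (by positivity)]
    calc (k : ℝ)⁻¹ * _ ≤ (k : ℝ)⁻¹ * √k := by
          gcongr
          exact Real.le_sqrt_of_sq_le hm
      _ = (√k)⁻¹ := by
          rw [← div_eq_inv_mul, Real.sqrt_div_self', one_div]
  calc volume (convexHull ℝ (Set.range w))
      ≤ ∑ m : Sym κ k,
          volume (Metric.closedBall ((k : ℝ)⁻¹ • ((m : Multiset κ).map w).sum) (√k)⁻¹) :=
        (measure_mono hsub).trans (measure_iUnion_fintype_le _ _)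
    _ = _ := by
        simp_rw [Measure.addHaar_closedBall volume _ (inv_nonneg.2 (Real.sqrt_nonneg (k : ℝ)))]
        simp [Sym.card_sym_eq_choose]

theorem choose_add_sub_one_le {n k : ℕ} (hk : 0 < k) :
    ((n + k - 1).choose k : ℝ) ≤ (Real.exp 1 * (n + k) / k) ^ k := by
  have hk' : (0 : ℝ) < k := by exact_mod_cast hk
  have h1 : ((n + k - 1).choose k : ℝ) ≤ ((n + k : ℕ) : ℝ) ^ k / (k.factorial : ℝ) :=
    (Nat.cast_le.2 (Nat.choose_le_choose k (Nat.sub_le _ _))).trans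
      (Nat.choose_le_pow_div k (n + k))
  have h2 := Real.pow_div_factorial_le_exp (k : ℝ) hk'.le k
  have hf : (0 : ℝ) < k.factorial := by exact_mod_cast k.factorial_pos
  refine h1.trans ?_
  rw [div_pow, mul_pow, ← Real.exp_nat_mul, mul_one, div_le_div_iff₀ hf (by positivity)]
  rw [div_le_iff₀ hf] at h2
  push_cast
  nlinarith [pow_nonneg (by positivity : (0 : ℝ) ≤ (n : ℝ) + k) k]

theorem log_two_le_log_div {d M : ℕ} (hd : 1 ≤ d) (hM : 2 * d ≤ M) :
    Real.log 2 ≤ Real.log ((M : ℝ) / d) := by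
  have hd' : (0 : ℝ) < d := by exact_mod_cast hd
  apply Real.log_le_log (by norm_num)
  rw [le_div_iff₀ hd']
  exact_mod_cast hM

theorem log_div_pos {d M : ℕ} (hd : 1 ≤ d) (hM : 2 * d ≤ M) :
    0 < Real.log ((M : ℝ) / d) :=
  (Real.log_pos (by norm_num)).trans_le (log_two_le_log_div hd hM)

theorem log_div_le {d M : ℕ} (hd : 1 ≤ d) (hM : 2 * d ≤ M) (hMd : (M : ℝ) ≤ Real.exp d) :
    Real.log ((M : ℝ) / d) ≤ d := by
  have hd' : (1 : ℝ) ≤ d := by exact_mod_cast hd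
  have hM' : (0 : ℝ) < M := by exact_mod_cast (by omega : 0 < M)
  rw [Real.log_div hM'.ne' (by positivity)]
  have h1 : Real.log M ≤ d := (Real.log_le_iff_le_exp hM').2 hMd
  have h2 := Real.log_nonneg hd'
  linarith

theorem choose_mul_inv_sqrt_pow_le {d M n : ℕ} (hd : 1 ≤ d) (hM : 2 * d ≤ M)
    (hMd : (M : ℝ) ≤ Real.exp d) (hn : n ≤ 13 * M) :
    ∃ k : ℕ, 0 < k ∧ ((n + k - 1).choose k : ℝ) * (√k)⁻¹ ^ d ≤
      (Real.exp 16 * √(Real.log ((M : ℝ) / d) / d)) ^ d := by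
  set t : ℝ := Real.log ((M : ℝ) / d) with ht
  have hd' : (1 : ℝ) ≤ d := by exact_mod_cast hd
  have hM' : (2 : ℝ) * d ≤ M := by exact_mod_cast hM
  have ht2 : Real.log 2 ≤ t := log_two_le_log_div hd hM
  have hlog := Real.log_two_gt_d9
  have ht0 : 0 < t := by linarith
  have htd : t ≤ d := log_div_le hd hM hMd
  have hexp : Real.exp t = M / d := Real.exp_log (by apply div_pos <;> linarith)
  have hk0 : 0 < ⌈(d : ℝ) / t⌉₊ := Nat.ceil_pos.2 (by positivity)
  -- This k balances the two factors: k ≥ d/t makes the radius at most √(t/d), while kt ≤ 2d keeps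
  -- the number of balls, at most e^(8tk), below e^(16d).
  refine ⟨⌈(d : ℝ) / t⌉₊, hk0, ?_⟩
  set k := ⌈(d : ℝ) / t⌉₊ with hk
  have hk' : (0 : ℝ) < k := by exact_mod_cast hk0
  have hk1 : (d : ℝ) / t ≤ k := Nat.le_ceil _
  have hk2 : (k : ℝ) < d / t + 1 := Nat.ceil_lt_add_one (by positivity)
  have hdk : (d : ℝ) ≤ k * t := (div_le_iff₀ ht0).1 hk1
  have hkt : (k : ℝ) * t ≤ 2 * d := by
    have : (k : ℝ) * t ≤ (d / t + 1) * t := by gcongr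
    rw [add_mul, div_mul_cancel₀ _ ht0.ne', one_mul] at this
    linarith
  have hk3 : (k : ℝ) ≤ 2 * M := by nlinarith
  have hn' : (n : ℝ) ≤ 13 * M := by exact_mod_cast hn
  have hbase : Real.exp 1 * (n + k) / k ≤ Real.exp (8 * t) := by
    have h1 : (1 : ℝ) / k ≤ t / d := by
      rw [div_le_div_iff₀ hk' (by linarith)]; linarith
    have he : Real.exp 1 ≤ 3 := by have := Real.exp_one_lt_d9; linarith
    have h64 : (64 : ℝ) ≤ Real.exp (6 * t) := by
      have : (64 : ℝ) = Real.exp (6 * Real.log 2) := by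
        rw [mul_comm, Real.exp_mul, Real.exp_log (by norm_num)]; norm_num
      rw [this]; gcongr
    have hte : t ≤ Real.exp t := by have := Real.add_one_le_exp t; linarith
    calc Real.exp 1 * (n + k) / k = Real.exp 1 * (n + k) * (1 / k) := by ring
      _ ≤ 3 * (13 * M + 2 * M) * (t / d) := by gcongr
      _ = 45 * t * (M / d) := by ring
      _ ≤ 64 * Real.exp t * Real.exp t := by rw [hexp]; gcongr; norm_num; rwa [← hexp]
      _ ≤ Real.exp (6 * t) * Real.exp t * Real.exp t := by gcongr
      _ = Real.exp (8 * t) := by rw [← Real.exp_add, ← Real.exp_add]; ring_nf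
  have hchoose : ((n + k - 1).choose k : ℝ) ≤ Real.exp 16 ^ d := by
    calc _ ≤ (Real.exp 1 * (n + k) / k) ^ k := choose_add_sub_one_le hk0
      _ ≤ Real.exp (8 * t) ^ k := by gcongr
      _ = Real.exp (8 * (k * t)) := by rw [← Real.exp_nat_mul]; ring_nf
      _ ≤ Real.exp (d * 16) := by apply Real.exp_le_exp.2; linarith
      _ = Real.exp 16 ^ d := by rw [← Real.exp_nat_mul]
  have hsqrt : (√(k : ℝ))⁻¹ ≤ √(t / d) := by
    rw [← Real.sqrt_inv]
    apply Real.sqrt_le_sqrt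
    rw [inv_eq_one_div, div_le_div_iff₀ hk' (by linarith)]
    linarith
  rw [mul_pow]
  gcongr

/-- The volume of the convex hull of at most `13 M` points of the unit ball of `ℝ^d`. -/
theorem volume_convexHull_range_le_of_card {d M : ℕ} (hd : 1 ≤ d) (hM : 2 * d ≤ M)
    (hMd : (M : ℝ) ≤ Real.exp d) {κ : Type*} [Fintype κ] (hκ : Fintype.card κ ≤ 13 * M)
    {w : κ → E d} (hw : ∀ i, ‖w i‖ ≤ 1) :
    volume (convexHull ℝ (Set.range w)) ≤
      ENNReal.ofReal ((Real.exp 16 * √(Real.log ((M : ℝ) / d) / d)) ^ d) *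
        volume (Metric.ball (0 : E d) 1) := by
  obtain ⟨k, hk, h⟩ := choose_mul_inv_sqrt_pow_le hd hM hMd hκ
  refine (volume_convexHull_range_le hw hk).trans ?_
  rw [← mul_assoc, ← ENNReal.ofReal_natCast, ← ENNReal.ofReal_mul (by positivity)]
  gcongr

/-! ### Geometry of the polytope -/

/-- Indices of the points that span the polytope. -/
abbrev GenIndex (d M : ℕ) (N : Fin (numBlocks d M) → Finset (E d)) : Type :=
  Fin d ⊕ (Σ k, N k) ⊕ Fin M

/-- The points whose absolute convex hull is the polytope. -/
def genPoint {d M : ℕ} (N : Fin (numBlocks d M) → Finset (E d)) (X : Fin M → UnitSphere d) :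
    GenIndex d M N → E d :=
  Sum.elim (fun i => EuclideanSpace.single i 1) (Sum.elim (fun p => p.2) (fun j => X j))

/-- The points that span the polytope, and their negatives. -/
def signedPoint {d M : ℕ} (N : Fin (numBlocks d M) → Finset (E d)) (X : Fin M → UnitSphere d) :
    GenIndex d M N ⊕ GenIndex d M N → E d :=
  Sum.elim (genPoint N X) (-genPoint N X)

section

variable {d M : ℕ} {N : Fin (numBlocks d M) → Finset (E d)}

theorem range_genPoint (X : Fin M → UnitSphere d) :
    Set.range (genPoint N X) =
      Set.range (fun i : Fin d => (EuclideanSpace.single i (1 : ℝ) : E d)) ∪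
      (⋃ k, (N k : Set (E d))) ∪ Set.range (fun j : Fin M => (X j : E d)) := by
  rw [genPoint, Set.Sum.elim_range, Set.Sum.elim_range, Set.union_assoc]
  congr 2
  ext x
  simp

theorem polytope_eq_convexHull (X : Fin M → UnitSphere d) :
    polytope d M N X = convexHull ℝ (Set.range (signedPoint N X)) := by
  rw [polytope, ← range_genPoint, ← convexHull_union_neg_eq_absConvexHull, signedPoint,
    Set.Sum.elim_range]
  congr 2
  ext x
  simp [neg_eq_iff_eq_neg]

theorem norm_genPoint_le (hN : IsBlockNets d M N) (X : Fin M → UnitSphere d)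
    (i : GenIndex d M N) : ‖genPoint N X i‖ ≤ 1 := by
  rcases i with i | p | j
  · simp [genPoint]
  · exact ((hN p.1).1 p.2.2).1.le
  · simp [genPoint]

theorem norm_signedPoint_le (hN : IsBlockNets d M N) (X : Fin M → UnitSphere d)
    (i : GenIndex d M N ⊕ GenIndex d M N) : ‖signedPoint N X i‖ ≤ 1 := by
  rcases i with i | i
  · exact norm_genPoint_le hN X i
  · simpa [signedPoint] using norm_genPoint_le hN X i

theorem absConvex_polytope (X : Fin M → UnitSphere d) : AbsConvex ℝ (polytope d M N X) :=
  absConvex_absConvexHull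

theorem polytope_subset_closedBall (hN : IsBlockNets d M N) (X : Fin M → UnitSphere d) :
    polytope d M N X ⊆ Metric.closedBall 0 1 := by
  rw [polytope_eq_convexHull]
  refine convexHull_min ?_ (convex_closedBall _ _)
  rintro _ ⟨i, rfl⟩
  simpa using norm_signedPoint_le hN X i

theorem single_mem_polytope (X : Fin M → UnitSphere d) (i : Fin d) :
    (EuclideanSpace.single i (1 : ℝ) : E d) ∈ polytope d M N X :=
  subset_absConvexHull (Or.inl (Or.inl ⟨i, rfl⟩))

theorem coe_mem_polytope (X : Fin M → UnitSphere d) (j : Fin M) :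
    (X j : E d) ∈ polytope d M N X :=
  subset_absConvexHull (Or.inr ⟨j, rfl⟩)

theorem zero_mem_polytope (hd : 1 ≤ d) (X : Fin M → UnitSphere d) :
    (0 : E d) ∈ polytope d M N X :=
  (absConvex_polytope X).1.zero_mem ⟨_, single_mem_polytope X ⟨0, hd⟩⟩

/-- By Cauchy–Schwarz this ball lies in the ℓ¹ ball, the absolute convex hull of the basis. -/
theorem closedBall_subset_polytope (hd : 1 ≤ d) (X : Fin M → UnitSphere d) :
    Metric.closedBall 0 (√d)⁻¹ ⊆ polytope d M N X := by
  intro x hx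
  rw [mem_closedBall_zero_iff] at hx
  have hd' : (0 : ℝ) < d := by exact_mod_cast hd
  have hsum : ∑ i, |x i| ≤ 1 := by
    have h1 : (∑ i, |x i|) ^ 2 ≤ d * ‖x‖ ^ 2 := by
      rw [EuclideanSpace.norm_sq_eq]
      have := sq_sum_le_card_mul_sum_sq (s := Finset.univ) (f := fun i => |x i|)
      simpa using this
    have h2 : (d : ℝ) * ‖x‖ ^ 2 ≤ 1 := by
      calc (d : ℝ) * ‖x‖ ^ 2 ≤ d * (√d)⁻¹ ^ 2 := by gcongr
        _ = 1 := by rw [inv_pow, Real.sq_sqrt hd'.le, mul_inv_cancel₀ hd'.ne']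
    nlinarith [Finset.sum_nonneg (fun i (_ : i ∈ Finset.univ) => abs_nonneg (x i))]
  have hx' : x = ∑ i, x i • (EuclideanSpace.single i (1 : ℝ) : E d) := by
    ext j
    simp [Finset.sum_apply, Pi.single_apply]
  have hV := absConvex_polytope (N := N) X
  rw [hx']
  -- The index `none` puts the missing weight 1 - ∑|x i| at the origin.
  have hmem := hV.2.sum_mem (t := Finset.univ) (w := fun o : Option (Fin d) =>
      o.elim (1 - ∑ i, |x i|) fun i => |x i|)
    (z := fun o => o.elim 0 fun i => (SignType.sign (x i) : ℝ) • EuclideanSpace.single i (1 : ℝ))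
    (by rintro (_ | i) - <;> simp [hsum])
    (by simp [Fintype.sum_option])
    (by
      rintro (_ | i) -
      · exact zero_mem_polytope hd X
      · refine hV.1.smul_mem ?_ (single_mem_polytope X i)
        rcases lt_trichotomy (x i) 0 with h | h | h <;> simp [h])
  simpa [Fintype.sum_option, smul_smul, abs_mul_sign] using hmem

theorem convexHull_range_eq_image_stdSimplex {F κ : Type*} [AddCommGroup F] [Module ℝ F]
    [Fintype κ] (w : κ → F) :
    convexHull ℝ (Set.range w) = (fun c : κ → ℝ => ∑ i, c i • w i) '' stdSimplex ℝ κ := by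
  classical
  have h := (Fintype.linearCombination ℝ w).image_convexHull
    (Set.range fun i : κ => (Pi.single i 1 : κ → ℝ))
  rw [convexHull_rangle_single_eq_stdSimplex, ← Set.range_comp] at h
  have e : (Fintype.linearCombination ℝ w : (κ → ℝ) → F) = fun c => ∑ i, c i • w i := by
    ext c; rw [Fintype.linearCombination_apply]
  rw [e] at h
  rw [h]
  congr 2
  ext i
  simp [Pi.single_apply]

theorem isCompact_polytope (X : Fin M → UnitSphere d) : IsCompact (polytope d M N X) := by
  rw [polytope_eq_convexHull]
  exact (Set.finite_range _).isCompact_convexHull ℝ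

theorem continuous_signedPoint (i : GenIndex d M N ⊕ GenIndex d M N) :
    Continuous fun X => signedPoint N X i := by
  have h : ∀ i : GenIndex d M N, Continuous fun X => genPoint N X i := by
    rintro (i | p | j)
    · exact continuous_const
    · exact continuous_const
    · exact continuous_subtype_val.comp (continuous_apply j)
  rcases i with i | i
  · exact h i
  · exact (h i).neg

/-- The relation is the projection, along the compact simplex of coefficients, of a closed set. It
serves the measurability of the bad event. -/
theorem isClosed_mem_polytope :
    IsClosed {p : E d × (Fin M → UnitSphere d) | p.1 ∈ polytope d M N p.2} := by
  let κ := GenIndex d M N ⊕ GenIndex d M N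
  have hc : IsClosed {q : stdSimplex ℝ κ × (E d × (Fin M → UnitSphere d)) |
      ∑ i, (q.1 : κ → ℝ) i • signedPoint N q.2.2 i = q.2.1} := by
    have h1 (i : κ) : Continuous fun q : stdSimplex ℝ κ × (E d × (Fin M → UnitSphere d)) =>
        (q.1 : κ → ℝ) i :=
      (continuous_apply i).comp (continuous_subtype_val.comp continuous_fst)
    have h2 (i : κ) : Continuous fun q : stdSimplex ℝ κ × (E d × (Fin M → UnitSphere d)) =>
        signedPoint N q.2.2 i :=
      (continuous_signedPoint i).comp (by fun_prop)
    exact isClosed_eq (continuous_finsetSum _ fun i _ => (h1 i).smul (h2 i)) (by fun_prop)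
  convert! isClosedMap_snd_of_compactSpace _ hc
  ext p
  simp only [polytope_eq_convexHull, convexHull_range_eq_image_stdSimplex]
  constructor
  · rintro ⟨c, hc, h⟩
    exact ⟨(⟨c, hc⟩, p), h, rfl⟩
  · rintro ⟨⟨c, p'⟩, h, rfl⟩
    exact ⟨c, c.2, h⟩

theorem one_le_blockLength (hd : 1 ≤ d) (hM : 2 * d ≤ M) : 1 ≤ blockLength d M := by
  refine Nat.one_le_iff_ne_zero.2 (Nat.ceil_pos.2 ?_).ne'
  exact div_pos (log_div_pos hd hM) (Real.log_pos (by norm_num))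

/-- There are at most d blocks, and rounding the logarithm up costs a factor of at most 5 over M/d.
-/
theorem numBlocks_mul_pow_le (hd : 1 ≤ d) (hM : 2 * d ≤ M) :
    numBlocks d M * 5 ^ blockLength d M ≤ 5 * M := by
  have hd' : (0 : ℝ) < d := by exact_mod_cast hd
  have hM' : (0 : ℝ) < M := by exact_mod_cast (by omega : 0 < M)
  have hl : (1 : ℝ) ≤ blockLength d M := by exact_mod_cast one_le_blockLength hd hM
  have h1 : numBlocks d M ≤ d := Nat.ceil_le.2 (div_le_self hd'.le hl)
  have h2 : (5 : ℝ) ^ blockLength d M ≤ 5 * (M / d) := by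
    have hlt : (blockLength d M : ℝ) < Real.logb 5 ((M : ℝ) / d) + 1 :=
      Nat.ceil_lt_add_one (div_nonneg (log_div_pos hd hM).le (Real.log_nonneg (by norm_num)))
    calc (5 : ℝ) ^ blockLength d M = (5 : ℝ) ^ (blockLength d M : ℝ) :=
          (Real.rpow_natCast _ _).symm
      _ ≤ 5 ^ (Real.logb 5 ((M : ℝ) / d) + 1) :=
          Real.rpow_le_rpow_of_exponent_le (by norm_num) hlt.le
      _ = 5 * (M / d) := by
          rw [Real.rpow_add (by norm_num), Real.rpow_logb (by norm_num) (by norm_num)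
            (by positivity), Real.rpow_one, mul_comm]
  have h3 : (numBlocks d M : ℝ) * 5 ^ blockLength d M ≤ 5 * M := by
    calc (numBlocks d M : ℝ) * 5 ^ blockLength d M ≤ d * (5 * (M / d)) := by gcongr
      _ = 5 * M := by field_simp
  exact_mod_cast h3

theorem card_signed_index_le (hd : 1 ≤ d) (hM : 2 * d ≤ M) (hN : IsBlockNets d M N) :
    Fintype.card (GenIndex d M N ⊕ GenIndex d M N) ≤ 13 * M := by
  have h1 : Fintype.card (Σ k, N k) ≤ 5 * M := by
    refine le_trans ?_ (numBlocks_mul_pow_le hd hM)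
    rw [Fintype.card_sigma]
    calc ∑ k, Fintype.card (N k) ≤ ∑ _k : Fin (numBlocks d M), 5 ^ blockLength d M :=
          Finset.sum_le_sum fun k _ => by simpa using (hN k).2.1
      _ = _ := by simp
  simp only [Fintype.card_sum, Fintype.card_fin]
  omega

theorem volume_polytope_le (hd : 1 ≤ d) (hM : 2 * d ≤ M) (hMd : (M : ℝ) ≤ Real.exp d)
    (hN : IsBlockNets d M N) (X : Fin M → UnitSphere d) :
    volume (polytope d M N X) ≤
      ENNReal.ofReal ((Real.exp 16 * √(Real.log ((M : ℝ) / d) / d)) ^ d) *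
        volume (Metric.ball (0 : E d) 1) := by
  rw [polytope_eq_convexHull]
  exact volume_convexHull_range_le_of_card hd hM hMd (card_signed_index_le hd hM hN)
    (norm_signedPoint_le hN X)

end

/-! ### Volume comparison: packing, spherical measure, the Euclidean ball -/

/-- If the translates of `K` by points of `A` stay inside `W`, a maximal family of disjoint
translates provides a net of `A` at scale `K - K`. -/
theorem exists_finset_net_of_add_subset {F : Type*} [AddCommGroup F] [MeasurableSpace F]
    [MeasurableAdd F] (μ : Measure F) [μ.IsAddLeftInvariant] {A K W : Set F}
    (hK : MeasurableSet K) (hK0 : μ K ≠ 0) (hW : μ W ≠ ⊤) (h : A + K ⊆ W) :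
    ∃ Λ : Finset F, (Λ : Set F) ⊆ A ∧
      (∀ x ∈ A, ∃ y ∈ Λ, ∃ k ∈ K, ∃ k' ∈ K, x - y = k - k') ∧ (Λ.card : ENNReal) * μ K ≤ μ W := by
  classical
  let P : Finset F → Prop := fun Λ =>
    (Λ : Set F) ⊆ A ∧ (Λ : Set F).PairwiseDisjoint fun x => x +ᵥ K
  have hP (Λ : Finset F) (hΛ : P Λ) : (Λ.card : ENNReal) * μ K ≤ μ W := by
    have h1 : μ (⋃ x ∈ Λ, x +ᵥ K) = ∑ x ∈ Λ, μ (x +ᵥ K) :=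
      measure_biUnion_finset hΛ.2 fun x _ => hK.const_vadd x
    simp only [measure_vadd, Finset.sum_const, nsmul_eq_mul] at h1
    rw [← h1]
    refine measure_mono (Set.iUnion₂_subset fun x hx => ?_)
    rintro _ ⟨k, hk, rfl⟩
    exact h (Set.add_mem_add (hΛ.1 hx) hk)
  have hKtop : K.Nonempty := nonempty_of_measure_ne_zero hK0
  obtain ⟨n, hn⟩ : ∃ n : ℕ, ∀ Λ, P Λ → Λ.card ≤ n := by
    obtain ⟨n, hn⟩ := ENNReal.exists_nat_gt (ENNReal.div_ne_top hW hK0)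
    refine ⟨n, fun Λ hΛ => ?_⟩
    have h2 : (Λ.card : ENNReal) < n := by
      refine lt_of_le_of_lt ?_ hn
      by_cases ht : μ K = ⊤
      · have := hP Λ hΛ
        rw [ht] at this
        rcases Nat.eq_zero_or_pos Λ.card with h0 | h0
        · simp [h0]
        · rw [ENNReal.mul_top (by exact_mod_cast h0.ne')] at this
          exact absurd (top_le_iff.1 this) hW
      · exact (ENNReal.le_div_iff_mul_le (Or.inl hK0) (Or.inl ht)).2 (hP Λ hΛ)
    exact_mod_cast h2.le
  let S : Set ℕ := {m | ∃ Λ, P Λ ∧ Λ.card = m}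
  have hS : S.Nonempty := ⟨0, ∅, ⟨by simp, by simp⟩, rfl⟩
  have hSb : BddAbove S := ⟨n, by rintro _ ⟨Λ, hΛ, rfl⟩; exact hn Λ hΛ⟩
  obtain ⟨Λ, hΛ, hcard⟩ := Nat.sSup_mem hS hSb
  refine ⟨Λ, hΛ.1, fun x hx => ?_, hP Λ hΛ⟩
  by_contra! hcon
  have hxΛ : x ∉ Λ := fun hxΛ => by
    obtain ⟨k, hk⟩ := hKtop
    exact hcon x hxΛ k hk k hk (by simp)
  have hins : P (insert x Λ) := by
    refine ⟨by simpa [Set.insert_subset_iff] using ⟨hx, hΛ.1⟩, ?_⟩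
    rw [Finset.coe_insert]
    refine hΛ.2.insert fun y hy _ => ?_
    rw [Set.disjoint_left]
    rintro _ ⟨k, hk, rfl⟩ ⟨k', hk', e⟩
    refine hcon y hy k' hk' k hk ?_
    simp only [vadd_eq_add] at e
    rw [sub_eq_sub_iff_add_eq_add, add_comm k' y, e]
  have := le_csSup hSb ⟨_, hins, rfl⟩
  rw [← hcard, Finset.card_insert_of_notMem hxΛ] at this
  omega

/-- The uniform measure of the part of the sphere inside a star-shaped set is at most the
volume of the set relative to that of the ball. -/
theorem sphereProb_mul_volume_ball_le {d : ℕ} (hd : 1 ≤ d) {K : Set (E d)}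
    (hK : MeasurableSet K) (hstar : StarConvex ℝ 0 K) :
    sphereProb d {x | (x : E d) ∈ K} * volume (Metric.ball (0 : E d) 1) ≤ volume K := by
  have : Nonempty (Fin d) := ⟨⟨0, hd⟩⟩
  have hs : MeasurableSet {x : UnitSphere d | (x : E d) ∈ K} := measurable_subtype_coe hK
  have hb0 : volume (Metric.ball (0 : E d) 1) ≠ 0 := (Metric.measure_ball_pos _ _ one_pos).ne'
  have hbt : volume (Metric.ball (0 : E d) 1) ≠ ⊤ := measure_ball_lt_top.ne
  have hd0 : (d : ENNReal) ≠ 0 := by exact_mod_cast (by omega : d ≠ 0)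
  -- The surface measure is d times the volume of the cone over the set, and star-shapedness puts
  -- that cone in `K`.
  have hsub : Set.Ioo (0 : ℝ) 1 • ((↑) '' {x : UnitSphere d | (x : E d) ∈ K}) ⊆ K := by
    rintro _ ⟨r, hr, _, ⟨x, hx, rfl⟩, rfl⟩
    exact hstar.smul_mem hx hr.1.le hr.2.le
  rw [sphereProb, Measure.smul_apply, Measure.toSphere_apply_univ, Measure.toSphere_apply' _ hs,
    smul_eq_mul]
  simp only [finrank_euclideanSpace, Fintype.card_fin]
  rw [ENNReal.mul_inv (Or.inl hd0) (Or.inl (ENNReal.natCast_ne_top d))]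
  calc _ = ((d : ENNReal)⁻¹ * d) * ((volume (Metric.ball (0 : E d) 1))⁻¹ *
        volume (Metric.ball (0 : E d) 1)) *
          volume (Set.Ioo (0 : ℝ) 1 • (Subtype.val '' {x : UnitSphere d | (x : E d) ∈ K})) := by ring
    _ ≤ volume K := by
      rw [ENNReal.inv_mul_cancel hd0 (ENNReal.natCast_ne_top d), ENNReal.inv_mul_cancel hb0 hbt,
        one_mul, one_mul]
      exact measure_mono hsub

/-- On the ball exp(-d‖v‖²) is at least e^(-d), and its full integral is (π/d)^(d/2); finally √π · e
≤ 5. -/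
theorem volume_unitBall_le {d : ℕ} (hd : 1 ≤ d) :
    volume (Metric.ball (0 : E d) 1) ≤ ENNReal.ofReal ((5 / √d) ^ d) := by
  have hd' : (0 : ℝ) < d := by exact_mod_cast hd
  have hval := GaussianFourier.integral_rexp_neg_mul_sq_norm (V := E d) hd'
  have hint' : Integrable fun v : E d => Real.exp (-(d : ℝ) * ‖v‖ ^ 2) := by
    by_contra hcon
    rw [integral_undef hcon] at hval
    exact (Real.rpow_pos_of_pos (by positivity) _).ne hval
  have h1 : volume.real (Metric.ball (0 : E d) 1) * Real.exp (-(d : ℝ)) ≤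
      ∫ v : E d, Real.exp (-(d : ℝ) * ‖v‖ ^ 2) := by
    calc volume.real (Metric.ball (0 : E d) 1) * Real.exp (-(d : ℝ))
        = ∫ _v in Metric.ball (0 : E d) 1, Real.exp (-(d : ℝ)) := by simp
      _ ≤ ∫ v in Metric.ball (0 : E d) 1, Real.exp (-(d : ℝ) * ‖v‖ ^ 2) := by
          refine setIntegral_mono_on (integrableOn_const measure_ball_lt_top.ne)
            hint'.integrableOn measurableSet_ball fun v hv => ?_
          rw [mem_ball_zero_iff] at hv
          apply Real.exp_le_exp.2
          have : ‖v‖ ^ 2 ≤ 1 := pow_le_one₀ (norm_nonneg _) hv.le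
          nlinarith
      _ ≤ _ := setIntegral_le_integral hint' (Filter.Eventually.of_forall fun v => by positivity)
  rw [hval, finrank_euclideanSpace, Fintype.card_fin] at h1
  have h2 : (Real.pi / d) ^ ((d : ℝ) / 2) = √(Real.pi / d) ^ d := by
    rw [Real.sqrt_eq_rpow, ← Real.rpow_natCast, ← Real.rpow_mul (by positivity)]
    ring_nf
  have h3 : volume.real (Metric.ball (0 : E d) 1) ≤ (5 / √d) ^ d := by
    have h4 : volume.real (Metric.ball (0 : E d) 1) ≤ √(Real.pi / d) ^ d * Real.exp d := by
      rw [h2, Real.exp_neg, ← div_eq_mul_inv, div_le_iff₀ (Real.exp_pos _)] at h1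
      exact h1
    refine h4.trans ?_
    have h5 : Real.exp d = Real.exp 1 ^ d := by rw [← Real.exp_nat_mul, mul_one]
    rw [h5, ← mul_pow]
    gcongr
    rw [Real.sqrt_div Real.pi_pos.le, div_mul_eq_mul_div]
    gcongr
    have h6 : √Real.pi ≤ 1.8 := Real.sqrt_le_iff.2 ⟨by norm_num, by
      have := Real.pi_lt_d2; norm_num; linarith⟩
    calc √Real.pi * Real.exp 1 ≤ 1.8 * 2.7182818286 := by
          gcongr; exact Real.exp_one_lt_d9.le
      _ ≤ 5 := by norm_num
  rw [← ENNReal.ofReal_toReal (measure_ball_lt_top.ne : volume (Metric.ball (0 : E d) 1) ≠ ⊤)]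
  exact ENNReal.ofReal_le_ofReal h3

/-! ### Volume of the operator norm ball -/

section Subgaussian

open ProbabilityTheory

theorem pi_cond_eq {α : Type*} [MeasurableSpace α] {n : ℕ} (μ : Measure α) [SigmaFinite μ]
    {A : Set α} (hA : MeasurableSet A) (hA0 : μ A ≠ 0) (hAt : μ A ≠ ⊤) :
    Measure.pi (fun _ : Fin n => cond μ A) =
      cond (Measure.pi fun _ : Fin n => μ) (Set.univ.pi fun _ => A) := by
  have := cond_isProbabilityMeasure_of_finite hA0 hAt
  refine Measure.pi_eq fun t ht => ?_
  rw [cond_apply (MeasurableSet.univ_pi fun _ => hA), ← Set.pi_inter_distrib, Measure.pi_pi,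
    Measure.pi_pi]
  simp_rw [cond_apply hA, Finset.prod_mul_distrib]
  simp [ENNReal.inv_pow]

theorem hasSubgaussianMGF_sum_pi {α : Type*} [MeasurableSpace α] {n : ℕ} {μ : Measure α}
    [IsProbabilityMeasure μ] {f : Fin n → α → ℝ} {c : Fin n → NNReal}
    (h : ∀ i, HasSubgaussianMGF (f i) (c i) μ) :
    HasSubgaussianMGF (fun ω : Fin n → α => ∑ i, f i (ω i)) (∑ i, c i)
      (Measure.pi fun _ => μ) := by
  refine HasSubgaussianMGF.sum_of_iIndepFun (iIndepFun_pi fun i => (h i).aemeasurable)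
    fun i _ => ?_
  refine HasSubgaussianMGF.of_map (Y := fun ω : Fin n → α => ω i)
    (measurable_pi_apply i).aemeasurable ?_
  rw [(measurePreserving_eval (fun _ : Fin n => μ) i).map_eq]
  exact h i

theorem hasSubgaussianMGF_id_cond_Icc {s : ℝ} (hs : 0 < s) :
    HasSubgaussianMGF id (‖s‖₊ ^ 2) (cond volume (Set.Icc (-s) s)) := by
  have hv : (volume : Measure ℝ) (Set.Icc (-s) s) ≠ 0 := by
    rw [Real.volume_Icc]; simpa using hs
  have := cond_isProbabilityMeasure_of_finite (μ := volume) hv (by simp)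
  have h := hasSubgaussianMGF_of_mem_Icc_of_integral_eq_zero (X := id)
    (μ := cond volume (Set.Icc (-s) s)) (a := -s) (b := s) aemeasurable_id
    (ae_cond_mem measurableSet_Icc) (by
      rw [ProbabilityTheory.cond, integral_smul_measure, integral_Icc_eq_integral_Ioc,
        ← intervalIntegral.integral_of_le (by linarith)]
      simp)
  have e : ‖s - -s‖₊ / 2 = ‖s‖₊ := by
    refine NNReal.eq ?_
    rw [sub_neg_eq_add, NNReal.coe_div, coe_nnnorm, coe_nnnorm, ← two_mul, norm_mul]
    simp
  rwa [e] at h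

theorem hasSubgaussianMGF_mul_left {Ω : Type*} [MeasurableSpace Ω] {μ : Measure Ω} {X : Ω → ℝ}
    {c : NNReal} (h : HasSubgaussianMGF X c μ) (r : ℝ) :
    HasSubgaussianMGF (fun ω => r * X ω) (‖r‖₊ ^ 2 * c) μ := by
  have e : (⟨r ^ 2, sq_nonneg r⟩ : NNReal) = ‖r‖₊ ^ 2 :=
    NNReal.eq (by change r ^ 2 = ‖r‖ ^ 2; simp)
  exact e ▸ h.const_mul r

/-- The columns of a matrix with independent entries, uniform in `[-s, s]`. -/
def cubeLaw (d : ℕ) (s : ℝ) : Measure (Fin d → Fin d → ℝ) :=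
  Measure.pi fun _ => Measure.pi fun _ => cond volume (Set.Icc (-s) s)

theorem hasSubgaussianMGF_bilin {d : ℕ} {s : ℝ} (hs : 0 < s) (x y : E d) :
    HasSubgaussianMGF (fun D : Fin d → Fin d → ℝ => ∑ i, x i * ∑ j, y j * D i j)
      (‖s‖₊ ^ 2 * ‖x‖₊ ^ 2 * ‖y‖₊ ^ 2) (cubeLaw d s) := by
  have hv : (volume : Measure ℝ) (Set.Icc (-s) s) ≠ 0 := by
    rw [Real.volume_Icc]; simpa using hs
  have := cond_isProbabilityMeasure_of_finite (μ := volume) hv (by simp)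
  have hsq (z : E d) : ‖z‖₊ ^ 2 = ∑ i, ‖z i‖₊ ^ 2 :=
    NNReal.eq (by push_cast; exact EuclideanSpace.norm_sq_eq z)
  have h1 := hasSubgaussianMGF_sum_pi (n := d) fun j =>
    hasSubgaussianMGF_mul_left (hasSubgaussianMGF_id_cond_Icc hs) (y j)
  have h2 := hasSubgaussianMGF_sum_pi (n := d) fun i => hasSubgaussianMGF_mul_left h1 (x i)
  rw [← Finset.sum_mul, ← Finset.sum_mul, ← hsq, ← hsq] at h2
  rw [show ‖s‖₊ ^ 2 * ‖x‖₊ ^ 2 * ‖y‖₊ ^ 2 = ‖x‖₊ ^ 2 * (‖y‖₊ ^ 2 * ‖s‖₊ ^ 2) by ring]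
  exact h2

/-- A maximal 1/2-separated set is a net; doubling it gives the 1-separated set in the ball of
radius 2 that `Besicovitch.card_le_of_separated` counts. -/
theorem exists_half_net_sphere (d : ℕ) :
    ∃ Λ : Finset (E d), Λ.card ≤ 5 ^ d ∧ (∀ y ∈ Λ, ‖y‖ = 1) ∧
      ∀ x : E d, ‖x‖ = 1 → ∃ y ∈ Λ, ‖x - y‖ ≤ 1 / 2 := by
  classical
  let P : Finset (E d) → Prop := fun Λ =>
    (∀ y ∈ Λ, ‖y‖ = 1) ∧ ∀ y ∈ Λ, ∀ z ∈ Λ, y ≠ z → 1 / 2 ≤ ‖y - z‖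
  have hP (Λ : Finset (E d)) (hΛ : P Λ) : Λ.card ≤ 5 ^ d := by
    have h2 : Function.Injective fun x : E d => (2 : ℝ) • x :=
      smul_right_injective _ two_ne_zero
    have := Besicovitch.card_le_of_separated (Λ.image fun x => (2 : ℝ) • x)
      (by
        simp only [Finset.mem_image]
        rintro _ ⟨y, hy, rfl⟩
        rw [norm_smul, hΛ.1 y hy]; norm_num)
      (by
        simp only [Finset.mem_image]
        rintro _ ⟨y, hy, rfl⟩ _ ⟨z, hz, rfl⟩ hne
        rw [← smul_sub, norm_smul]
        have := hΛ.2 y hy z hz fun h => hne (by rw [h])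
        norm_num
        linarith)
    simpa [Finset.card_image_of_injective _ h2] using this
  let S : Set ℕ := {m | ∃ Λ, P Λ ∧ Λ.card = m}
  have hSb : BddAbove S := ⟨5 ^ d, by rintro _ ⟨Λ, hΛ, rfl⟩; exact hP Λ hΛ⟩
  obtain ⟨Λ, hΛ, hcard⟩ := Nat.sSup_mem (s := S) ⟨0, ∅, ⟨by simp, by simp⟩, rfl⟩ hSb
  refine ⟨Λ, hP Λ hΛ, hΛ.1, fun x hx => ?_⟩
  by_contra! hcon
  have hxΛ : x ∉ Λ := fun h => by have := hcon x h; norm_num at this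
  have hins : P (insert x Λ) := by
    refine ⟨by simpa [hx] using hΛ.1, ?_⟩
    intro y hy z hz hne
    rcases Finset.mem_insert.1 hy with hyx | hy <;> rcases Finset.mem_insert.1 hz with hzx | hz
    · exact absurd (hyx.trans hzx.symm) hne
    · rw [hyx]; exact (hcon z hz).le
    · rw [hzx, norm_sub_rev]; exact (hcon y hy).le
    · exact hΛ.2 y hy z hz hne
  have := le_csSup hSb ⟨_, hins, rfl⟩
  rw [← hcard, Finset.card_insert_of_notMem hxΛ] at this
  omega

/-- The linear map with prescribed columns. -/
def ofCols {d : ℕ} (D : Fin d → E d) : E d →ₗ[ℝ] E d :=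
  ∑ i, (LinearMap.toSpanSingleton ℝ (E d) (D i)).comp (EuclideanSpace.projₗ i)

theorem ofCols_apply {d : ℕ} (D : Fin d → E d) (x : E d) : ofCols D x = ∑ i, x i • D i := by
  simp [ofCols]

/-- The matrices, given by their columns, of Euclidean operator norm at most one. -/
def opBall (d : ℕ) : Set (Fin d → E d) :=
  {D | ∀ x : E d, ‖ofCols D x‖ ≤ ‖x‖}

/-- Passing from the net to the sphere loses a factor 2 in each variable, so 1/4 on the net becomes
1. -/
theorem mem_opBall_of_net {d : ℕ} {Λ : Finset (E d)}
    (hΛ : ∀ x : E d, ‖x‖ = 1 → ∃ y ∈ Λ, ‖x - y‖ ≤ 1 / 2) {D : Fin d → E d}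
    (hD : ∀ x ∈ Λ, ∀ y ∈ Λ, ∑ i, x i * ∑ j, y j * D i j ≤ 1 / 4) : D ∈ opBall d := by
  let A : E d →L[ℝ] E d := LinearMap.toContinuousLinearMap (ofCols D)
  have hA (x : E d) : A x = ∑ i, x i • D i := ofCols_apply D x
  have hinner (x y : E d) : inner ℝ y (A x) = ∑ i, x i * ∑ j, y j * D i j := by
    rw [hA, inner_sum]
    refine Finset.sum_congr rfl fun i _ => ?_
    rw [inner_smul_right, PiLp.inner_apply]
    simp [mul_comm]
  have hvec (v : E d) (m : ℝ) (hm : 0 ≤ m) (h : ∀ y ∈ Λ, inner ℝ y v ≤ m) : ‖v‖ ≤ 2 * m := by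
    rcases eq_or_ne v 0 with rfl | hv
    · simpa using hm
    · have hv0 : 0 < ‖v‖ := norm_pos_iff.2 hv
      obtain ⟨y, hy, hxy⟩ := hΛ (‖v‖⁻¹ • v) (by
        rw [norm_smul, norm_inv, norm_norm, inv_mul_cancel₀ hv0.ne'])
      have h1 : inner ℝ (‖v‖⁻¹ • v) v = ‖v‖ := by
        rw [real_inner_smul_left, real_inner_self_eq_norm_sq]; field_simp
      have h2 : inner ℝ (‖v‖⁻¹ • v - y) v ≤ 1 / 2 * ‖v‖ :=
        (real_inner_le_norm _ _).trans (by gcongr)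
      rw [inner_sub_left, h1] at h2
      linarith [h y hy]
  have hnet (y : E d) (hy : y ∈ Λ) : ‖A y‖ ≤ 1 / 2 := by
    have := hvec (A y) (1 / 4) (by norm_num) fun z hz => by rw [hinner]; exact hD y hy z hz
    linarith
  have hop : ‖A‖ ≤ 1 / 2 + ‖A‖ / 2 := by
    refine A.opNorm_le_of_unit_norm (by positivity) fun x hx => ?_
    obtain ⟨y, hy, hxy⟩ := hΛ x hx
    calc ‖A x‖ = ‖A y + A (x - y)‖ := by rw [map_sub, add_sub_cancel]
      _ ≤ ‖A y‖ + ‖A (x - y)‖ := norm_add_le _ _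
      _ ≤ 1 / 2 + ‖A‖ * (1 / 2) := by
          gcongr
          · exact hnet y hy
          · exact (A.le_opNorm _).trans (by gcongr)
      _ = _ := by ring
  intro x
  exact (A.le_opNorm x).trans (mul_le_of_le_one_left (norm_nonneg _) (by linarith))

theorem isClosed_opBall (d : ℕ) : IsClosed (opBall d) := by
  simp only [opBall, ofCols_apply]
  rw [Set.ofPred_forall]
  exact isClosed_iInter fun x => isClosed_le (by fun_prop) (by fun_prop)

/-- A matrix with independent entries uniform in [-s, s] has operator norm at most 1 with
probability at least 1/2, so the ball fills half of a cube of side 2s = 1/(8√d). -/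
theorem volume_opBall_ge {d : ℕ} (hd : 1 ≤ d) :
    ENNReal.ofReal ((1 / (8 * √d)) ^ (d * d)) ≤ 2 * volume (opBall d) := by
  classical
  have hd' : (1 : ℝ) ≤ d := by exact_mod_cast hd
  set s : ℝ := 1 / (16 * √d) with hs
  have hs0 : 0 < s := by positivity
  have hv : (volume : Measure ℝ) (Set.Icc (-s) s) ≠ 0 := by
    rw [Real.volume_Icc]; simpa using hs0
  have := cond_isProbabilityMeasure_of_finite (μ := volume) hv (by simp)
  have hprob : IsProbabilityMeasure (cubeLaw d s) := by unfold cubeLaw; infer_instance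
  obtain ⟨Λ, hcard, hunit, hnet⟩ := exists_half_net_sphere d
  let T : (Fin d → Fin d → ℝ) → (Fin d → E d) := fun D i => WithLp.toLp 2 (D i)
  have hT : MeasurePreserving T volume volume :=
    volume_preserving_pi fun _ => PiLp.volume_preserving_toLp (Fin d)
  let bad : E d × E d → Set (Fin d → Fin d → ℝ) := fun p =>
    {D | 1 / 4 ≤ ∑ i, p.1 i * ∑ j, p.2 j * D i j}
  -- The exponent is (1/4)²/(2s²) = 8d, enough for a union bound over 25^d pairs.
  have hbad (p : E d × E d) (hp : p ∈ Λ ×ˢ Λ) :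
      (cubeLaw d s).real (bad p) ≤ Real.exp (-8 * d) := by
    obtain ⟨h1, h2⟩ := Finset.mem_product.1 hp
    refine ((hasSubgaussianMGF_bilin hs0 p.1 p.2).measure_ge_le (by norm_num)).trans ?_
    apply Real.exp_le_exp.2
    have hs2 : s ^ 2 = 1 / (256 * d) := by
      rw [hs, div_pow, mul_pow, Real.sq_sqrt (by linarith)]; norm_num
    push_cast
    rw [hunit _ h1, hunit _ h2, Real.norm_of_nonneg hs0.le, hs2]
    apply le_of_eq
    field_simp
    norm_num
  have hsum : (cubeLaw d s).real (⋃ p ∈ Λ ×ˢ Λ, bad p) ≤ 1 / 2 := by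
    calc (cubeLaw d s).real (⋃ p ∈ Λ ×ˢ Λ, bad p)
        ≤ ∑ p ∈ Λ ×ˢ Λ, (cubeLaw d s).real (bad p) := measureReal_biUnion_finset_le _ _
      _ ≤ ∑ _p ∈ Λ ×ˢ Λ, Real.exp (-8 * d) := Finset.sum_le_sum hbad
      _ = (Λ.card : ℝ) * Λ.card * Real.exp (-8 * d) := by
          rw [Finset.sum_const, Finset.card_product, nsmul_eq_mul, Nat.cast_mul]
      _ ≤ 5 ^ d * 5 ^ d * Real.exp (-8 * d) := by
          have : (Λ.card : ℝ) ≤ 5 ^ d := by exact_mod_cast hcard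
          gcongr
      _ = (25 * Real.exp (-8)) ^ d := by
          rw [mul_pow, ← Real.exp_nat_mul, ← mul_pow]; norm_num [mul_comm]
      _ ≤ (1 / 2) ^ d := by
          gcongr
          have h8 : Real.exp (-8) = (Real.exp 8)⁻¹ := Real.exp_neg 8
          have h2 : (2 : ℝ) ^ 8 ≤ Real.exp 8 := by
            have : Real.exp 8 = Real.exp 1 ^ 8 := by rw [← Real.exp_nat_mul]; norm_num
            rw [this]; gcongr; have := Real.exp_one_gt_d9; linarith
          rw [h8, ← div_eq_mul_inv, div_le_iff₀ (Real.exp_pos _)]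
          linarith
      _ ≤ 1 / 2 := by
          calc ((1 : ℝ) / 2) ^ d ≤ (1 / 2) ^ 1 :=
                pow_le_pow_of_le_one (by norm_num) (by norm_num) hd
            _ = 1 / 2 := pow_one _
  have hgood : (⋃ p ∈ Λ ×ˢ Λ, bad p)ᶜ ⊆ T ⁻¹' opBall d := by
    intro D hD
    simp only [Set.mem_compl_iff, Set.mem_iUnion, not_exists, bad, Set.mem_ofPred, not_le] at hD
    exact mem_opBall_of_net hnet fun x hx y hy =>
      (hD (x, y) (Finset.mem_product.2 ⟨hx, hy⟩)).le
  have hhalf : (1 / 2 : ENNReal) ≤ cubeLaw d s (T ⁻¹' opBall d) := by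
    have hm : MeasurableSet (⋃ p ∈ Λ ×ˢ Λ, bad p) := by
      refine Finset.measurableSet_biUnion _ fun p _ => ?_
      exact measurableSet_le measurable_const (by fun_prop)
    have h1 := probReal_compl_eq_one_sub (μ := cubeLaw d s) hm
    have h2 : (1 / 2 : ℝ) ≤ (cubeLaw d s).real (T ⁻¹' opBall d) :=
      le_trans (by linarith) (measureReal_mono hgood)
    have h3 := ENNReal.ofReal_le_ofReal h2
    rw [ofReal_measureReal] at h3
    refine le_trans (le_of_eq ?_) h3
    rw [ENNReal.ofReal_div_of_pos two_pos]; simp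
  have hcube : cubeLaw d s = cond volume
      (Set.univ.pi fun _ : Fin d => Set.univ.pi fun _ : Fin d => Set.Icc (-s) s) := by
    rw [cubeLaw, pi_cond_eq volume measurableSet_Icc hv (by simp), pi_cond_eq]
    · rfl
    · exact MeasurableSet.univ_pi fun _ => measurableSet_Icc
    · rw [Measure.pi_pi]; exact Finset.prod_ne_zero_iff.2 fun _ _ => hv
    · rw [Measure.pi_pi]; exact ENNReal.prod_ne_top (by simp)
  have hvol : volume (Set.univ.pi fun _ : Fin d => Set.univ.pi fun _ : Fin d => Set.Icc (-s) s)
      = ENNReal.ofReal ((1 / (8 * √d)) ^ (d * d)) := by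
    simp only [volume_pi_pi, Real.volume_Icc, Finset.prod_const, Finset.card_univ,
      Fintype.card_fin]
    rw [← pow_mul, ENNReal.ofReal_pow (by positivity)]
    congr 2
    rw [hs]; field_simp; norm_num
  have hvol0 : ENNReal.ofReal ((1 / (8 * √d)) ^ (d * d)) ≠ 0 := by
    rw [Ne, ENNReal.ofReal_eq_zero, not_le]; positivity
  rw [hcube, cond_apply (MeasurableSet.univ_pi fun _ => MeasurableSet.univ_pi fun _ =>
    measurableSet_Icc), hvol] at hhalf
  have hle : (1 / 2 : ENNReal) ≤
      (ENNReal.ofReal ((1 / (8 * √d)) ^ (d * d)))⁻¹ * volume (opBall d) := by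
    refine hhalf.trans ?_
    gcongr
    rw [← hT.measure_preimage (isClosed_opBall d).measurableSet.nullMeasurableSet]
    exact measure_mono Set.inter_subset_right
  rw [mul_comm, ← div_eq_mul_inv, ENNReal.le_div_iff_mul_le (Or.inl hvol0)
    (Or.inl ENNReal.ofReal_ne_top)] at hle
  calc ENNReal.ofReal ((1 / (8 * √d)) ^ (d * d))
      = 2 * (1 / 2 * ENNReal.ofReal ((1 / (8 * √d)) ^ (d * d))) := by
        rw [← mul_assoc, ENNReal.mul_div_cancel two_ne_zero ENNReal.ofNat_ne_top, one_mul]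
    _ ≤ _ := by gcongr

end Subgaussian

/-! ### Nets of linear maps and the estimate for a fixed target body -/

theorem ofCols_single {d : ℕ} (D : Fin d → E d) (i : Fin d) :
    ofCols D (EuclideanSpace.single i 1) = D i := by
  classical
  simp [ofCols_apply]

theorem ofCols_sub {d : ℕ} (D D' : Fin d → E d) (x : E d) :
    ofCols (D - D') x = ofCols D x - ofCols D' x := by
  simp [ofCols_apply, smul_sub]

theorem ofCols_smul {d : ℕ} (c : ℝ) (D : Fin d → E d) (x : E d) :
    ofCols (c • D) x = c • ofCols D x := by
  simp [ofCols_apply, Finset.smul_sum, smul_comm c]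

theorem norm_ofCols_le_of_mem_smul {d : ℕ} {c : ℝ} (hc : 0 ≤ c) {D : Fin d → E d}
    (hD : D ∈ c • opBall d) (x : E d) : ‖ofCols D x‖ ≤ c * ‖x‖ := by
  obtain ⟨D', hD', rfl⟩ := hD
  simp only [ofCols_smul, norm_smul, Real.norm_of_nonneg hc]
  exact mul_le_mul_of_nonneg_left (hD' x) hc

/-- The matrices, given by their columns, of determinant at least one in absolute value that
map the standard basis into `ρ V`. -/
def goodMaps {d : ℕ} (V : Set (E d)) (ρ : ℝ) : Set (Fin d → E d) :=
  {T | 1 ≤ |LinearMap.det (ofCols T)| ∧ ∀ i, T i ∈ ρ • V}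

section

variable {d M : ℕ} {V : Set (E d)} {α ρ : ℝ}

theorem add_mem_two_mul_smul (hV : AbsConvex ℝ V) (hρ : 0 ≤ ρ) {x y : E d} (hx : x ∈ ρ • V)
    (hy : y ∈ ρ • V) : x + y ∈ (2 * ρ) • V := by
  rw [two_mul, hV.2.add_smul hρ hρ]
  exact Set.add_mem_add hx hy

theorem mem_smul_of_norm_le (hball : Metric.closedBall 0 (√d)⁻¹ ⊆ V) (hρ : 0 < ρ) {x : E d}
    (hx : ‖x‖ ≤ ρ * (√d)⁻¹) : x ∈ ρ • V := by
  rw [Set.mem_smul_set_iff_inv_smul_mem₀ hρ.ne']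
  apply hball
  rw [mem_closedBall_zero_iff, norm_smul, norm_inv, Real.norm_of_nonneg hρ.le,
    inv_mul_le_iff₀ hρ]
  exact hx

/-- Translates of ε times the operator ball, ε = ρ/(2√d), by good maps have columns in 2ρV. The
ratio of volumes, (10ρα/√d) / (ε/(8√d)) = 160α√d per coordinate, does not depend on ρ. -/
theorem exists_net_goodMaps (hd : 1 ≤ d) (hV : AbsConvex ℝ V)
    (hball : Metric.closedBall 0 (√d)⁻¹ ⊆ V) (hα : 0 < α)
    (hvol : volume V ≤ ENNReal.ofReal (α ^ d) * volume (Metric.ball (0 : E d) 1)) (hρ : 0 < ρ) :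
    ∃ Λ : Finset (Fin d → E d), (Λ : Set (Fin d → E d)) ⊆ goodMaps V ρ ∧
      (∀ T ∈ goodMaps V ρ, ∃ S ∈ Λ, ∀ x : E d, ‖ofCols S x - ofCols T x‖ ≤ ρ * (√d)⁻¹ * ‖x‖) ∧
      (Λ.card : ENNReal) ≤ ENNReal.ofReal (2 * (160 * α * √d) ^ (d * d)) := by
  have hd' : (0 : ℝ) < d := by exact_mod_cast hd
  have hsd : 0 < √(d : ℝ) := Real.sqrt_pos.2 hd'
  set ε : ℝ := ρ * (√d)⁻¹ / 2 with hε
  have hε0 : 0 < ε := by positivity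
  let K : Set (Fin d → E d) := ε • opBall d
  let W : Set (Fin d → E d) := Set.univ.pi fun _ => (2 * ρ) • V
  have hfin : Module.finrank ℝ (Fin d → E d) = d * d := by
    rw [Module.finrank_pi_fintype]; simp
  have hop := volume_opBall_ge hd
  have hop0 : volume (opBall d) ≠ 0 := by
    intro h
    rw [h, mul_zero, nonpos_iff_eq_zero, ENNReal.ofReal_eq_zero] at hop
    exact absurd hop (not_le.2 (by positivity))
  have hKvol : volume K = ENNReal.ofReal (ε ^ (d * d)) * volume (opBall d) := by
    rw [Measure.addHaar_smul, hfin, abs_of_pos (by positivity)]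
  have hKge : ENNReal.ofReal ((ε / (8 * √d)) ^ (d * d)) ≤ 2 * volume K := by
    calc ENNReal.ofReal ((ε / (8 * √d)) ^ (d * d))
        = ENNReal.ofReal (ε ^ (d * d)) * ENNReal.ofReal ((1 / (8 * √d)) ^ (d * d)) := by
          rw [← ENNReal.ofReal_mul (by positivity), ← mul_pow, mul_one_div]
      _ ≤ ENNReal.ofReal (ε ^ (d * d)) * (2 * volume (opBall d)) := by gcongr
      _ = 2 * volume K := by rw [hKvol]; ring
  have hK0 : volume K ≠ 0 := by
    rw [hKvol]
    refine mul_ne_zero ?_ hop0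
    rw [Ne, ENNReal.ofReal_eq_zero, not_le]; positivity
  have hWvol : volume W ≤ ENNReal.ofReal ((2 * ρ * α * (5 / √d)) ^ (d * d)) := by
    have h1 : volume ((2 * ρ) • V) ≤ ENNReal.ofReal ((2 * ρ * α * (5 / √d)) ^ d) := by
      rw [Measure.addHaar_smul, finrank_euclideanSpace, Fintype.card_fin,
        abs_of_pos (by positivity)]
      calc _ ≤ ENNReal.ofReal ((2 * ρ) ^ d) *
            (ENNReal.ofReal (α ^ d) * ENNReal.ofReal ((5 / √d) ^ d)) := by
            gcongr
            exact hvol.trans (by gcongr; exact volume_unitBall_le hd)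
        _ = _ := by
            rw [← ENNReal.ofReal_mul (by positivity), ← ENNReal.ofReal_mul (by positivity),
              ← mul_pow, ← mul_pow]
            ring_nf
    simp only [W, volume_pi_pi, Finset.prod_const, Finset.card_univ, Fintype.card_fin]
    rw [pow_mul, ENNReal.ofReal_pow (by positivity)]
    gcongr
  obtain ⟨Λ, h1, h2, h3⟩ := exists_finset_net_of_add_subset volume (A := goodMaps V ρ) (K := K)
    (W := W) ((isClosed_opBall d).measurableSet.const_smul₀ ε) hK0
    (ne_top_of_le_ne_top ENNReal.ofReal_ne_top hWvol) (by
      rintro _ ⟨T, hT, D, hD, rfl⟩ i -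
      refine add_mem_two_mul_smul hV hρ.le (hT.2 i) (mem_smul_of_norm_le hball hρ ?_)
      have := norm_ofCols_le_of_mem_smul hε0.le hD (EuclideanSpace.single i 1)
      rw [ofCols_single] at this
      refine this.trans ?_
      simp only [PiLp.norm_single, norm_one, mul_one, hε]
      have : 0 < ρ * (√d)⁻¹ := by positivity
      linarith)
  refine ⟨Λ, h1, fun T hT => ?_, ?_⟩
  · obtain ⟨S, hS, k, hk, k', hk', e⟩ := h2 T hT
    refine ⟨S, hS, fun x => ?_⟩
    rw [norm_sub_rev, ← ofCols_sub, e, ofCols_sub]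
    refine (norm_sub_le _ _).trans ?_
    have h4 := norm_ofCols_le_of_mem_smul hε0.le hk x
    have h5 := norm_ofCols_le_of_mem_smul hε0.le hk' x
    have h6 : ρ * (√d)⁻¹ * ‖x‖ = ε * ‖x‖ + ε * ‖x‖ := by rw [hε]; ring
    linarith
  · have h4 : (Λ.card : ENNReal) * ENNReal.ofReal ((ε / (8 * √d)) ^ (d * d)) ≤
        2 * ENNReal.ofReal ((2 * ρ * α * (5 / √d)) ^ (d * d)) := by
      calc _ ≤ (Λ.card : ENNReal) * (2 * volume K) := by gcongr
        _ = 2 * (Λ.card * volume K) := by ring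
        _ ≤ _ := by gcongr; exact h3.trans hWvol
    have h5 : (Λ.card : ℝ) * (ε / (8 * √d)) ^ (d * d) ≤
        2 * (2 * ρ * α * (5 / √d)) ^ (d * d) := by
      rw [← ENNReal.ofReal_natCast, ← ENNReal.ofReal_mul (by positivity),
        ← ENNReal.ofReal_ofNat 2, ← ENNReal.ofReal_mul (by positivity)] at h4
      exact (ENNReal.ofReal_le_ofReal_iff (by positivity)).1 h4
    rw [← ENNReal.ofReal_natCast]
    apply ENNReal.ofReal_le_ofReal
    rw [← le_div_iff₀ (by positivity), mul_div_assoc, ← div_pow] at h5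
    convert! h5 using 3
    rw [hε]
    have hss : √(d : ℝ) * √d = d := Real.mul_self_sqrt hd'.le
    field_simp
    norm_num

/-- The preimage of ρV has volume ρ^d vol V / |det S|; this is where the determinant condition is
needed. -/
theorem sphereProb_image_mem_le (hd : 1 ≤ d) (hV : AbsConvex ℝ V) (hVc : IsCompact V)
    (h0 : (0 : E d) ∈ V)
    (hvol : volume V ≤ ENNReal.ofReal (α ^ d) * volume (Metric.ball (0 : E d) 1)) (hρ : 0 < ρ)
    {S : Fin d → E d} (hS : 1 ≤ |LinearMap.det (ofCols S)|) :
    sphereProb d {x | ofCols S (x : E d) ∈ ρ • V} ≤ ENNReal.ofReal ((ρ * α) ^ d) := by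
  have hb0 : volume (Metric.ball (0 : E d) 1) ≠ 0 := (Metric.measure_ball_pos _ _ one_pos).ne'
  have hbt : volume (Metric.ball (0 : E d) 1) ≠ ⊤ := measure_ball_lt_top.ne
  have hdet : LinearMap.det (ofCols S) ≠ 0 := fun h => by norm_num [h] at hS
  have hclosed : IsClosed (ofCols S ⁻¹' (ρ • V)) :=
    (hVc.smul ρ).isClosed.preimage (ofCols S).continuous_of_finiteDimensional
  have hstar : StarConvex ℝ 0 (ofCols S ⁻¹' (ρ • V)) := by
    refine ((hV.2.smul ρ).linear_preimage (ofCols S)).starConvex ?_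
    rw [Set.mem_preimage, map_zero]
    exact ⟨0, h0, smul_zero ρ⟩
  have h1 := sphereProb_mul_volume_ball_le hd hclosed.measurableSet hstar
  rw [← ENNReal.mul_le_mul_iff_left hb0 hbt]
  refine h1.trans ?_
  rw [Measure.addHaar_preimage_linearMap _ hdet, Measure.addHaar_smul, finrank_euclideanSpace,
    Fintype.card_fin, abs_of_pos (by positivity : 0 < ρ ^ d)]
  calc _ ≤ ENNReal.ofReal 1 * (ENNReal.ofReal (ρ ^ d) *
        (ENNReal.ofReal (α ^ d) * volume (Metric.ball (0 : E d) 1))) := by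
        gcongr
        rw [abs_inv]
        exact inv_le_one_of_one_le₀ hS
    _ = _ := by
        rw [ENNReal.ofReal_one, one_mul, ← mul_assoc, ← ENNReal.ofReal_mul (by positivity),
          ← mul_pow]

theorem sampleLaw_exists_goodMaps_le (hd : 1 ≤ d) (hV : AbsConvex ℝ V) (hVc : IsCompact V)
    (hball : Metric.closedBall 0 (√d)⁻¹ ⊆ V) (hα : 0 < α)
    (hvol : volume V ≤ ENNReal.ofReal (α ^ d) * volume (Metric.ball (0 : E d) 1)) (hρ : 0 < ρ) :
    sampleLaw d M {X | ∃ T ∈ goodMaps V ρ, ∀ j, ofCols T (X j : E d) ∈ ρ • V} ≤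
      ENNReal.ofReal (2 * (160 * α * √d) ^ (d * d) * ((2 * ρ * α) ^ d) ^ M) := by
  have := isProbabilityMeasure_sphereProb hd
  obtain ⟨Λ, h1, h2, h3⟩ := exists_net_goodMaps hd hV hball hα hvol hρ
  have h0 : (0 : E d) ∈ V := hball (by simp)
  have hsub : {X : Fin M → UnitSphere d | ∃ T ∈ goodMaps V ρ, ∀ j, ofCols T (X j : E d) ∈ ρ • V}
      ⊆ ⋃ S ∈ Λ, Set.univ.pi fun _ => {x : UnitSphere d | ofCols S (x : E d) ∈ (2 * ρ) • V} := by
    rintro X ⟨T, hT, hX⟩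
    obtain ⟨S, hS, hST⟩ := h2 T hT
    refine Set.mem_iUnion₂.2 ⟨S, hS, fun j _ => ?_⟩
    have h4 := hST (X j)
    rw [norm_eq_of_mem_sphere, mul_one] at h4
    have h5 := add_mem_two_mul_smul hV hρ.le (hX j) (mem_smul_of_norm_le hball hρ h4)
    rwa [add_sub_cancel] at h5
  calc _ ≤ ∑ S ∈ Λ, sampleLaw d M
        (Set.univ.pi fun _ => {x : UnitSphere d | ofCols S (x : E d) ∈ (2 * ρ) • V}) :=
        (measure_mono hsub).trans (measure_biUnion_finset_le _ _)
    _ ≤ ∑ _S ∈ Λ, ENNReal.ofReal ((2 * ρ * α) ^ d) ^ M := by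
        refine Finset.sum_le_sum fun S hS => ?_
        rw [sampleLaw, Measure.pi_pi, Finset.prod_const, Finset.card_univ, Fintype.card_fin]
        gcongr
        exact sphereProb_image_mem_le hd hV hVc h0 hvol (by positivity) (h1 hS).1
    _ = (Λ.card : ENNReal) * ENNReal.ofReal (((2 * ρ * α) ^ d) ^ M) := by
        rw [Finset.sum_const, nsmul_eq_mul, ← ENNReal.ofReal_pow (by positivity)]
    _ ≤ _ := by
        rw [ENNReal.ofReal_mul (by positivity)]
        gcongr

end

/-! ### The bad event for pairs of samples -/

theorem continuous_det_ofCols (d : ℕ) :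
    Continuous fun T : Fin d → E d => LinearMap.det (ofCols T) := by
  classical
  let b := (EuclideanSpace.basisFun (Fin d) ℝ).toBasis
  simp_rw [← LinearMap.det_toMatrix b]
  refine Continuous.matrix_det (continuous_matrix fun i j => ?_)
  simp only [LinearMap.toMatrix_apply, b, OrthonormalBasis.coe_toBasis,
    EuclideanSpace.basisFun_apply, ofCols_single, OrthonormalBasis.coe_toBasis_repr_apply,
    EuclideanSpace.basisFun_repr]
  fun_prop

/-- The pairs of samples for which some linear map of determinant at least one in absolute value
maps the second polytope into `ρ` times the first one. -/
def badPairs (d M : ℕ) (N : Fin (numBlocks d M) → Finset (E d)) (ρ : ℝ) :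
    Set ((Fin M → UnitSphere d) × (Fin M → UnitSphere d)) :=
  {X | ∃ T ∈ goodMaps (polytope d M N X.1) ρ,
    ∀ j, ofCols T (X.2 j : E d) ∈ ρ • polytope d M N X.1}

section

variable {d M : ℕ} {N : Fin (numBlocks d M) → Finset (E d)} {ρ : ℝ}

/-- The columns of a witness have norm at most ρ, so the event is a projection along a compact set.
Fubini and the swap of samples need its measurability. -/
theorem isClosed_badPairs (hN : IsBlockNets d M N) (hρ : 0 < ρ) :
    IsClosed (badPairs d M N ρ) := by
  let B : Set (Fin d → E d) := Set.univ.pi fun _ => Metric.closedBall 0 ρ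
  have : CompactSpace B :=
    isCompact_iff_compactSpace.1 (isCompact_univ_pi fun _ => isCompact_closedBall _ _)
  have hpoly (f : B × ((Fin M → UnitSphere d) × (Fin M → UnitSphere d)) → E d)
      (hf : Continuous f) : IsClosed {q | f q ∈ ρ • polytope d M N q.2.1} := by
    simp_rw [Set.mem_smul_set_iff_inv_smul_mem₀ hρ.ne']
    have hg : Continuous fun q : B × ((Fin M → UnitSphere d) × (Fin M → UnitSphere d)) =>
        (ρ⁻¹ • f q, q.2.1) := by fun_prop
    exact isClosed_mem_polytope.preimage hg
  have hT (i : Fin d) : Continuous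
      fun q : B × ((Fin M → UnitSphere d) × (Fin M → UnitSphere d)) => (q.1 : Fin d → E d) i :=
    (continuous_apply i).comp (continuous_subtype_val.comp continuous_fst)
  have hclosed : IsClosed {q : B × ((Fin M → UnitSphere d) × (Fin M → UnitSphere d)) |
      (1 ≤ |LinearMap.det (ofCols (q.1 : Fin d → E d))| ∧
        ∀ i, (q.1 : Fin d → E d) i ∈ ρ • polytope d M N q.2.1) ∧
      ∀ j, ofCols (q.1 : Fin d → E d) (q.2.2 j : E d) ∈ ρ • polytope d M N q.2.1} := by
    simp only [Set.ofPred_and, Set.ofPred_forall]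
    refine IsClosed.inter (IsClosed.inter ?_ ?_) ?_
    · exact isClosed_le continuous_const
        ((continuous_det_ofCols d).comp (continuous_subtype_val.comp continuous_fst)).abs
    · exact isClosed_iInter fun i => hpoly _ (hT i)
    · refine isClosed_iInter fun j => hpoly _ ?_
      simp only [ofCols_apply]
      have hX (i : Fin d) : Continuous
          fun q : B × ((Fin M → UnitSphere d) × (Fin M → UnitSphere d)) =>
            (q.2.2 j : E d) i := by fun_prop
      exact continuous_finsetSum _ fun i _ => (hX i).smul (hT i)
  convert! isClosedMap_snd_of_compactSpace _ hclosed
  ext X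
  constructor
  · rintro ⟨T, hT, hX⟩
    refine ⟨(⟨T, fun i _ => ?_⟩, X), ⟨hT, hX⟩, rfl⟩
    obtain ⟨y, hy, hyT⟩ := hT.2 i
    have h1 := polytope_subset_closedBall hN X.1 hy
    rw [mem_closedBall_zero_iff] at h1 ⊢
    rw [← hyT]
    simp only [norm_smul, Real.norm_of_nonneg hρ.le]
    exact mul_le_of_le_one_right hρ.le h1
  · rintro ⟨⟨T, X'⟩, ⟨hT, hX⟩, rfl⟩
    exact ⟨T, hT, hX⟩

theorem prod_badPairs_le (hd : 1 ≤ d) (hM : 2 * d ≤ M) (hMd : (M : ℝ) ≤ Real.exp d)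
    (hN : IsBlockNets d M N) (hρ : 0 < ρ) {α : ℝ}
    (hα : α = Real.exp 16 * √(Real.log ((M : ℝ) / d) / d)) :
    ((sampleLaw d M).prod (sampleLaw d M)) (badPairs d M N ρ) ≤
      ENNReal.ofReal (2 * (160 * α * √d) ^ (d * d) * ((2 * ρ * α) ^ d) ^ M) := by
  have := isProbabilityMeasure_sphereProb hd
  have : IsProbabilityMeasure (sampleLaw d M) := by unfold sampleLaw; infer_instance
  have hd' : (0 : ℝ) < d := by exact_mod_cast hd
  have hL := log_div_pos hd hM
  have hα0 : 0 < α := by rw [hα]; positivity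
  rw [Measure.prod_apply (isClosed_badPairs hN hρ).measurableSet]
  calc _ ≤ ∫⁻ _X, ENNReal.ofReal (2 * (160 * α * √d) ^ (d * d) * ((2 * ρ * α) ^ d) ^ M)
        ∂(sampleLaw d M) := by
        refine lintegral_mono fun X => ?_
        exact sampleLaw_exists_goodMaps_le hd (absConvex_polytope X) (isCompact_polytope X)
          (closedBall_subset_polytope hd X) hα0 (hα ▸ volume_polytope_le hd hM hMd hN X) hρ
    _ = _ := by simp

theorem netBound_mul_probBound_le (hd : 1 ≤ d) (hM : 2 * d ≤ M) :
    2 * (160 * (Real.exp 16 * √(Real.log ((M : ℝ) / d) / d)) * √d) ^ (d * d) *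
      ((2 * √(2 * (Real.exp (-60) / 8 * d / Real.log ((M : ℝ) / d))) *
        (Real.exp 16 * √(Real.log ((M : ℝ) / d) / d))) ^ d) ^ M ≤ Real.exp (-(d * M)) := by
  have hd1 : (1 : ℝ) ≤ d := by exact_mod_cast hd
  have hd' : (0 : ℝ) < d := by linarith
  have hM' : (2 : ℝ) * d ≤ M := by exact_mod_cast hM
  have hL := log_div_pos hd hM
  set t := Real.log ((M : ℝ) / d) with ht
  have hsd : 0 < √(d : ℝ) := Real.sqrt_pos.2 hd'
  have hst : 0 < √t := Real.sqrt_pos.2 hL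
  have hprob : 2 * √(2 * (Real.exp (-60) / 8 * d / t)) * (Real.exp 16 * √(t / d)) =
      Real.exp (-14) := by
    have h1 : 2 * (Real.exp (-60) / 8 * d / t) = (Real.exp (-30) / 2) ^ 2 * (d / t) := by
      rw [div_pow, ← Real.exp_nat_mul]; norm_num; ring
    have h2 : √(d / t) * √(t / d) = 1 := by
      rw [← Real.sqrt_mul (by positivity), div_mul_div_cancel₀ hL.ne', div_self hd'.ne',
        Real.sqrt_one]
    rw [h1, Real.sqrt_mul (by positivity), Real.sqrt_sq (by positivity)]
    calc _ = Real.exp (-30) * Real.exp 16 * (√(d / t) * √(t / d)) := by ring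
      _ = Real.exp (-14) := by rw [h2, mul_one, ← Real.exp_add]; norm_num
  have hnet : 160 * (Real.exp 16 * √(t / d)) * √d ≤ Real.exp (22 + M / d) := by
    have h1 : √(t / d) * √d = √t := by
      rw [Real.sqrt_div hL.le, div_mul_cancel₀ _ hsd.ne']
    have h2 : √t ≤ Real.exp (M / d) := by
      apply Real.sqrt_le_iff.2 ⟨(Real.exp_pos _).le, ?_⟩
      have hMd : 0 < (M : ℝ) / d := div_pos (by linarith) hd'
      have h3 : t ≤ M / d := (Real.log_le_sub_one_of_pos hMd).trans (by linarith)
      have h4 := Real.add_one_le_exp ((M : ℝ) / d)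
      nlinarith
    have h160 : (160 : ℝ) ≤ Real.exp 6 := by
      have h5 : Real.exp 6 = Real.exp 1 ^ 6 := by rw [← Real.exp_nat_mul]; norm_num
      have h6 : (2.7 : ℝ) ^ 6 ≤ Real.exp 1 ^ 6 := by
        gcongr; have := Real.exp_one_gt_d9; linarith
      rw [h5]; refine le_trans ?_ h6; norm_num
    calc _ = 160 * Real.exp 16 * (√(t / d) * √d) := by ring
      _ ≤ Real.exp 6 * Real.exp 16 * Real.exp (M / d) := by rw [h1]; gcongr
      _ = _ := by rw [← Real.exp_add, ← Real.exp_add]; norm_num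
  rw [hprob]
  have h2 : (2 : ℝ) ≤ Real.exp (d * M) := by
    have := Real.add_one_le_exp ((d : ℝ) * M)
    nlinarith
  calc _ ≤ Real.exp (d * M) * Real.exp (22 + M / d) ^ (d * d) *
        (Real.exp (-14) ^ d) ^ M := by gcongr
    -- As M ≥ 2d, 22d² ≤ 11dM and the exponent is at most (2 + 11 - 14)dM = -dM.
    _ = Real.exp (d * M + (22 * d * d + d * M) - 14 * (d * M)) := by
        rw [← Real.exp_nat_mul, ← Real.exp_nat_mul, ← Real.exp_nat_mul, ← Real.exp_add,
          ← Real.exp_add]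
        congr 1
        push_cast
        field_simp
        ring
    _ ≤ _ := by
        apply Real.exp_le_exp.2
        nlinarith

end

/-! ### From the Banach–Mazur distance to the bad event -/

section

variable {d : ℕ} {K₁ K₂ : Set (E d)}

theorem half_sub_mem {V : Set (E d)} (hV : AbsConvex ℝ V) {x y : E d} (hx : x ∈ V) (hy : y ∈ V) :
    (1 / 2 : ℝ) • (x - y) ∈ V := by
  have h := hV.2 hx (hV.1.neg_mem_iff.2 hy) (by norm_num : (0 : ℝ) ≤ 1 / 2)
    (by norm_num : (0 : ℝ) ≤ 1 / 2) (by norm_num)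
  rwa [← smul_add, ← sub_eq_add_neg] at h

/-- For symmetric bodies the centres in the Banach–Mazur distance may be taken to be zero. -/
theorem subset_of_translate_subset (h₁ : AbsConvex ℝ K₁) (h₂ : AbsConvex ℝ K₂)
    {T : E d ≃ₗ[ℝ] E d} {a b : E d} {r : ℝ}
    (hl : (fun x => x - a) '' K₁ ⊆ T '' ((fun x => x - b) '' K₂))
    (hr : T '' ((fun x => x - b) '' K₂) ⊆ r • ((fun x => x - a) '' K₁)) :
    (∀ x ∈ K₁, T.symm x ∈ K₂) ∧ ∀ y ∈ K₂, T y ∈ r • K₁ := by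
  constructor
  · intro x hx
    obtain ⟨_, ⟨y, hy, rfl⟩, e⟩ := hl ⟨x, hx, rfl⟩
    -- Subtracting the inclusions for `x` and `-x` cancels both centres.
    obtain ⟨_, ⟨z, hz, rfl⟩, e'⟩ := hl ⟨-x, h₁.1.neg_mem_iff.2 hx, rfl⟩
    convert half_sub_mem h₂ hy hz using 1
    rw [T.symm_apply_eq, map_smul, map_sub]
    simp only [map_sub] at e e'
    have : T y - T z = (2 : ℝ) • x := by
      rw [← sub_sub_sub_cancel_right (T y) (T z) (T b), e, e']
      module
    rw [this]
    module
  · intro y hy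
    obtain ⟨_, ⟨x, hx, rfl⟩, e⟩ := hr ⟨_, ⟨y, hy, rfl⟩, rfl⟩
    obtain ⟨_, ⟨z, hz, rfl⟩, e'⟩ := hr ⟨_, ⟨-y, h₂.1.neg_mem_iff.2 hy, rfl⟩, rfl⟩
    refine ⟨(1 / 2 : ℝ) • (x - z), half_sub_mem h₁ hx hz, ?_⟩
    simp only [map_sub, map_neg] at e e'
    have : r • (x - z) = (2 : ℝ) • T y := by
      rw [← sub_sub_sub_cancel_right x z a, smul_sub, e, e']
      module
    simp only [smul_comm r, this]
    module

/-- The infimum of the empty set would be 0, so an admissible r must be exhibited: T = √d · id with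
r = d works. -/
theorem exists_lt_of_banachMazur_lt (hd : 1 ≤ d)
    (h₁ : Metric.closedBall 0 (√d)⁻¹ ⊆ K₁) (h₁' : K₁ ⊆ Metric.closedBall 0 1)
    (h₂ : Metric.closedBall 0 (√d)⁻¹ ⊆ K₂) (h₂' : K₂ ⊆ Metric.closedBall 0 1) {s : ℝ}
    (hs : banachMazur K₁ K₂ < s) :
    ∃ r, 0 < r ∧ r < s ∧ ∃ (T : E d ≃ₗ[ℝ] E d) (a b : E d),
      (fun x => x - a) '' K₁ ⊆ T '' ((fun x => x - b) '' K₂) ∧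
      T '' ((fun x => x - b) '' K₂) ⊆ r • ((fun x => x - a) '' K₁) := by
  have hd' : (0 : ℝ) < d := by exact_mod_cast hd
  have hsd : 0 < √(d : ℝ) := Real.sqrt_pos.2 hd'
  suffices hne : {r : ℝ | 0 < r ∧ ∃ (T : E d ≃ₗ[ℝ] E d) (a b : E d),
      (fun x => x - a) '' K₁ ⊆ T '' ((fun x => x - b) '' K₂) ∧
      T '' ((fun x => x - b) '' K₂) ⊆ r • ((fun x => x - a) '' K₁)}.Nonempty by
    obtain ⟨r, ⟨hr, h⟩, hrs⟩ := exists_lt_of_csInf_lt hne hs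
    exact ⟨r, hr, hrs, h⟩
  refine ⟨(d : ℝ), hd', LinearEquiv.smulOfNeZero ℝ (E d) (√d) hsd.ne', 0, 0, ?_, ?_⟩
  · simp only [sub_zero, Set.image_id']
    intro x hx
    have hx1 := mem_closedBall_zero_iff.1 (h₁' hx)
    refine ⟨(√d)⁻¹ • x, h₂ ?_, ?_⟩
    · rw [mem_closedBall_zero_iff, norm_smul, Real.norm_of_nonneg (by positivity)]
      exact mul_le_of_le_one_right (by positivity) hx1
    · simp [smul_smul, hsd.ne']
  · simp only [sub_zero, Set.image_id']
    rintro _ ⟨y, hy, rfl⟩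
    have hy1 := mem_closedBall_zero_iff.1 (h₂' hy)
    rw [Set.mem_smul_set_iff_inv_smul_mem₀ hd'.ne']
    apply h₁
    simp only [mem_closedBall_zero_iff, LinearEquiv.smulOfNeZero_apply]
    rw [smul_smul, norm_smul,
      Real.norm_of_nonneg (by positivity)]
    refine (mul_le_of_le_one_right (by positivity) hy1).trans (le_of_eq ?_)
    have := Real.mul_self_sqrt hd'.le
    field_simp
    linarith

theorem ofCols_eq (f : E d →ₗ[ℝ] E d) : ofCols (fun i => f (EuclideanSpace.single i 1)) = f :=
  (EuclideanSpace.basisFun (Fin d) ℝ).toBasis.ext fun i => by simp [ofCols_single]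

theorem exists_linearMap_one_le_det {T : E d ≃ₗ[ℝ] E d} {r : ℝ} (hr : 0 < r)
    (hl : ∀ x ∈ K₁, T.symm x ∈ K₂) (hr' : ∀ y ∈ K₂, T y ∈ r • K₁) :
    (∃ f : E d →ₗ[ℝ] E d, 1 ≤ |LinearMap.det f| ∧ ∀ y ∈ K₂, f y ∈ √r • K₁) ∨
      ∃ f : E d →ₗ[ℝ] E d, 1 ≤ |LinearMap.det f| ∧ ∀ x ∈ K₁, f x ∈ √r • K₂ := by
  have hs : 0 < √r := Real.sqrt_pos.2 hr
  have hdet : 0 < |LinearMap.det (T : E d →ₗ[ℝ] E d)| := abs_pos.2 T.isUnit_det'.ne_zero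
  rcases le_total (√r ^ d) |LinearMap.det (T : E d →ₗ[ℝ] E d)| with h | h
  · left
    refine ⟨(√r)⁻¹ • (T : E d →ₗ[ℝ] E d), ?_, fun y hy => ?_⟩
    · rw [LinearMap.det_smul, finrank_euclideanSpace, Fintype.card_fin, abs_mul,
        abs_of_pos (by positivity), inv_pow, le_inv_mul_iff₀ (by positivity), mul_one]
      exact h
    · obtain ⟨x, hx, e⟩ := hr' y hy
      refine ⟨x, hx, ?_⟩
      simp only [LinearMap.smul_apply, LinearEquiv.coe_coe, ← e, smul_smul]
      rw [inv_mul_eq_div, Real.div_sqrt]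
  · right
    refine ⟨√r • (T.symm : E d →ₗ[ℝ] E d), ?_, fun x hx => ⟨_, hl x hx, rfl⟩⟩
    rw [LinearMap.det_smul, finrank_euclideanSpace, Fintype.card_fin, abs_mul,
      abs_of_pos (by positivity), LinearEquiv.det_coe_symm, abs_inv, ← div_eq_mul_inv,
      one_le_div hdet]
    exact h

end

section

variable {d M : ℕ} {N : Fin (numBlocks d M) → Finset (E d)}

theorem mem_badPairs_of_linearMap {X : (Fin M → UnitSphere d) × (Fin M → UnitSphere d)}
    {ρ s : ℝ} (hs : 0 ≤ s) (hsρ : s ≤ ρ) {f : E d →ₗ[ℝ] E d} (hf : 1 ≤ |LinearMap.det f|)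
    (h : ∀ y ∈ polytope d M N X.2, f y ∈ s • polytope d M N X.1) : X ∈ badPairs d M N ρ := by
  have hmono : s • polytope d M N X.1 ⊆ ρ • polytope d M N X.1 :=
    (absConvex_polytope X.1).1.smul_mono
      (by rwa [Real.norm_of_nonneg hs, Real.norm_of_nonneg (hs.trans hsρ)])
  refine ⟨fun i => f (EuclideanSpace.single i 1), ⟨?_, fun i => ?_⟩, fun j => ?_⟩
  · rwa [ofCols_eq]
  · exact hmono (h _ (single_mem_polytope X.2 i))
  · rw [ofCols_eq]
    exact hmono (h _ (coe_mem_polytope X.2 j))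

theorem banachMazur_le_subset_badPairs (hd : 1 ≤ d) (hN : IsBlockNets d M N) {s : ℝ}
    (hs : 0 < s) :
    {X : (Fin M → UnitSphere d) × (Fin M → UnitSphere d) |
      banachMazur (polytope d M N X.1) (polytope d M N X.2) ≤ s} ⊆
      badPairs d M N √(2 * s) ∪ Prod.swap ⁻¹' badPairs d M N √(2 * s) := by
  intro X hX
  -- Doubling s leaves room for an infimum that need not be attained.
  obtain ⟨r, hr, hrs, T, a, b, hl, hr'⟩ := exists_lt_of_banachMazur_lt hd
    (closedBall_subset_polytope hd X.1) (polytope_subset_closedBall hN X.1)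
    (closedBall_subset_polytope hd X.2) (polytope_subset_closedBall hN X.2)
    (lt_of_le_of_lt hX (by linarith : s < 2 * s))
  obtain ⟨h1, h2⟩ :=
    subset_of_translate_subset (absConvex_polytope X.1) (absConvex_polytope X.2) hl hr'
  have hle : √r ≤ √(2 * s) := Real.sqrt_le_sqrt hrs.le
  rcases exists_linearMap_one_le_det hr h1 h2 with ⟨f, hf, hfX⟩ | ⟨f, hf, hfX⟩
  · exact Set.mem_union_left _ (mem_badPairs_of_linearMap (Real.sqrt_nonneg r) hle hf hfX)
  · have hswap : X.swap ∈ badPairs d M N √(2 * s) :=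
      mem_badPairs_of_linearMap (Real.sqrt_nonneg r) hle hf hfX
    exact Set.mem_union_right _ hswap

end

end Gluskin

end

theorem theorem2p2 :
    ∃ a : ℝ, 0 < a ∧ ∀ d M : ℕ, 1 ≤ d → 2 * d ≤ M → (M : ℝ) ≤ Real.exp (d : ℝ) →
      ∀ N : Fin (Gluskin.numBlocks d M) → Finset (Gluskin.E d), Gluskin.IsBlockNets d M N →
        ((Gluskin.sampleLaw d M).prod (Gluskin.sampleLaw d M))
            {X : (Fin M → Gluskin.UnitSphere d) × (Fin M → Gluskin.UnitSphere d) |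
              Gluskin.banachMazur (Gluskin.polytope d M N X.1) (Gluskin.polytope d M N X.2) ≤
                a * (d : ℝ) / Real.log ((M : ℝ) / (d : ℝ))} ≤
          ENNReal.ofReal (2 * Real.exp (-((d : ℝ) * (M : ℝ)))) := by
  -- The constant is chosen so that 2ρα = e^(-30) · e^16 = e^(-14).
  refine ⟨Real.exp (-60) / 8, by positivity, fun d M hd hM hMd N hN => ?_⟩
  have := Gluskin.isProbabilityMeasure_sphereProb hd
  have : IsProbabilityMeasure (Gluskin.sampleLaw d M) := by
    unfold Gluskin.sampleLaw; infer_instance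
  have hd' : (0 : ℝ) < d := by exact_mod_cast hd
  have hL := Gluskin.log_div_pos hd hM
  have hs : 0 < Real.exp (-60) / 8 * (d : ℝ) / Real.log ((M : ℝ) / d) := by positivity
  have hρ := Real.sqrt_pos.2 (mul_pos two_pos hs)
  have hbad := (Gluskin.prod_badPairs_le hd hM hMd hN hρ rfl).trans
    (ENNReal.ofReal_le_ofReal (Gluskin.netBound_mul_probBound_le hd hM))
  refine (measure_mono (Gluskin.banachMazur_le_subset_badPairs hd hN hs)).trans
    ((measure_union_le _ _).trans ?_)
  rw [Measure.measurePreserving_swap.measure_preimage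
    (Gluskin.isClosed_badPairs hN hρ).measurableSet.nullMeasurableSet,
    two_mul (Real.exp (-((d : ℝ) * (M : ℝ)))), ENNReal.ofReal_add (Real.exp_pos _).le (Real.exp_pos _).le]
  exact add_le_add hbad hbad
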